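/- Let $n\ge 0$ and let $d\mu_n=\prod_{j=1}^n e^{-|u_j|^2}\,\frac{dx_j\,dy_j}{\pi}$ ($u_j=x_j+\mathrm i y_j$) be the Gaussian measure on $\mathbb C^n$. Let $\mathcal H\subset L^2(\mathbb C^n,d\mu_n)$ be the closed subspace generated by the holomorphic functions of $\bar u=(\bar u_1,\dots,\bar u_n)$, and on polynomials in $\bar u$ put $a_j=\partial/\partial\bar u_j$ and $a_j^\dagger=$ multiplication by $\bar u_j$. Let $B$ and $C$ be complex $n\times n$ matrices with $B={}^tB$, and let $$H=\tfrac12\,(a^\dagger Ba^\dagger+a\bar Ba+2a^\dagger Ca)=\tfrac12\sum_{j,k}\bigl(B_{jk}a_j^\dagger a_k^\dagger+\bar B_{jk}a_ja_k+2C_{jk}a_j^\dagger a_k\bigr),$$ with the polynomials in $\bar u$ as its domain. Suppose that $H$ is formally self-adjoint, that is, $\langle Hf,g\rangle=\langle f,Hg\rangle$ for all polynomials $f,g$. Then the closure of $H$ in $\mathcal H$, again denoted by $H$, is self-adjoint, and there is exactly one strongly continuous one-parameter unitary group $(e^{\mathrm itH})_{t\in\mathbb R}$ on $\mathcal H$ with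 generator $H$. Put $$\mathcal A=\begin{pmatrix}-C&-B\\ \bar B&\bar C\end{pmatrix},$$ and let $\Phi=\Phi(t)$ and $\Psi=\Psi(t)$ be the upper left and upper right $n\times n$ blocks of $e^{\mathrm it\mathcal A}$. Then for every $t\in\mathbb R$ one has $$e^{\mathrm it\mathcal A}=\begin{pmatrix}\Phi&\Psi\\ \bar\Psi&\bar\Phi\end{pmatrix},$$ the matrix $\Phi$ is invertible, and $e^{\mathrm itH}$ has the integral kernel $$U(\bar u,v)=c\,\exp\left(\tfrac12\,(v\ \ \bar u)\begin{pmatrix}A^{11}&A^{12}\\A^{21}&A^{22}\end{pmatrix}\begin{pmatrix}v\\ \bar u\end{pmatrix}\right),\qquad A^{jk}={}^tA^{kj},$$ $$A^{22}=-\Phi^{-1}\Psi,\qquad A^{21}=\Phi^{-1},\qquad A^{11}=\bar\Psi\,\Phi^{-1},\qquad c=\bigl(\det(\Phi e^{\mathrm itC})\bigr)^{-1/2},$$ that is, for every $f\in\mathcal H$, $$(e^{\mathrm itH}f)(\bar u)=\int_{\mathbb C^n}U(\bar u,v)\,f(\bar v)\,d\mu_n(v)\quad\text{for almost every }u,$$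 where the integral converges absolutely for every $u$. Here the square root is the branch that is continuous in $t$: $c=c(t)$ is continuous on $\mathbb R$, $c(0)=1$, and $c(t)^2\det(\Phi(t)e^{\mathrm itC})=1$ for all $t$. -/

import Mathlib

open MeasureTheory
open scoped InnerProductSpace ComplexConjugate ENNReal

namespace Bargmann

/-! ### The Gaussian measure and the holomorphic (Bargmann) representation space -/

/-- The Gaussian probability measure `e^{-|u|²} dx dy / π` on `ℂ`, where `u = x + i y`. -/
noncomputable def gaussian₁ : Measure ℂ :=
  (volume : Measure ℂ).withDensity fun z => ENNReal.ofReal (Real.exp (-‖z‖ ^ 2) / Real.pi)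

/-- The product measure `dμ_n = ∏ⱼ e^{-ūⱼuⱼ} dūⱼ duⱼ / (2πi)` on `ℂⁿ`. -/
noncomputable def gaussian (n : ℕ) : Measure (Fin n → ℂ) :=
  Measure.pi fun _ => gaussian₁

lemma measurable_density :
    Measurable fun z : ℂ => ENNReal.ofReal (Real.exp (-‖z‖ ^ 2) / Real.pi) := by
  fun_prop

lemma integrable_pow_mul_exp (k : ℕ) :
    Integrable (fun z : ℂ => ‖z‖ ^ k * Real.exp (-‖z‖ ^ 2)) volume := by
  have h := Complex.integral_rpow_mul_exp_neg_rpow (p := 2) (q := (k : ℝ)) (by norm_num)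
    (by have : (0 : ℝ) ≤ k := k.cast_nonneg
        linarith)
  refine Integrable.congr (f := fun z : ℂ => ‖z‖ ^ (k : ℝ) * Real.exp (-‖z‖ ^ (2 : ℝ))) ?_ ?_
  · by_contra hn
    rw [integral_undef hn] at h
    have hG : 0 < Real.Gamma (((k : ℝ) + 2) / 2) := Real.Gamma_pos_of_pos (by positivity)
    have hp := Real.pi_pos
    have : 0 < (2 * Real.pi / 2) * Real.Gamma (((k : ℝ) + 2) / 2) := by positivity
    linarith
  · refine Filter.Eventually.of_forall fun z => ?_
    simp only [Real.rpow_natCast]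
    norm_num [Real.rpow_ofNat]

lemma integrable_pow_gaussian₁ (k : ℕ) : Integrable (fun z : ℂ => ‖z‖ ^ k) gaussian₁ := by
  rw [gaussian₁, integrable_withDensity_iff measurable_density
    (Filter.Eventually.of_forall fun _ => ENNReal.ofReal_lt_top)]
  refine ((integrable_pow_mul_exp k).div_const Real.pi).congr
    (Filter.Eventually.of_forall fun z => ?_)
  have : 0 ≤ Real.exp (-‖z‖ ^ 2) / Real.pi := by positivity
  simp only [ENNReal.toReal_ofReal this]
  ring

instance : IsFiniteMeasure gaussian₁ := by
  have h := integrable_pow_gaussian₁ 0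
  simp only [pow_zero] at h
  simpa [integrable_const_iff] using h

instance : gaussian₁.IsOpenPosMeasure := by
  refine Measure.AbsolutelyContinuous.isOpenPosMeasure (μ := (volume : Measure ℂ)) ?_
  refine withDensity_absolutelyContinuous' measurable_density.aemeasurable
    (Filter.Eventually.of_forall fun z => ?_)
  have : 0 < Real.exp (-‖z‖ ^ 2) / Real.pi := by have := Real.pi_pos; positivity
  simpa using this

instance (n : ℕ) : IsFiniteMeasure (gaussian n) := by
  unfold gaussian; infer_instance

instance (n : ℕ) : (gaussian n).IsOpenPosMeasure := by
  unfold gaussian; infer_instance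

/-- The square-integrable antiholomorphic functions, as a subspace of `L²(ℂⁿ, dμ_n)`: the classes
of functions `u ↦ F(ū)` with `F` holomorphic on `ℂⁿ`. -/
noncomputable def antiholomorphic (n : ℕ) : Submodule ℂ (Lp ℂ 2 (gaussian n)) where
  carrier := {f | ∃ F : (Fin n → ℂ) → ℂ, Differentiable ℂ F ∧
    f =ᵐ[gaussian n] fun u => F (star u)}
  add_mem' := by
    rintro f g ⟨F, hF, hf⟩ ⟨G, hG, hg⟩
    refine ⟨fun w => F w + G w, hF.add hG, ?_⟩
    filter_upwards [Lp.coeFn_add f g, hf, hg] with u h h1 h2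
    rw [h, Pi.add_apply, h1, h2]
  zero_mem' := ⟨fun _ => 0, differentiable_const 0, by
    filter_upwards [Lp.coeFn_zero ℂ 2 (gaussian n)] with u h
    rw [h, Pi.zero_apply]⟩
  smul_mem' := by
    rintro c f ⟨F, hF, hf⟩
    refine ⟨fun w => c • F w, hF.const_smul c, ?_⟩
    filter_upwards [Lp.coeFn_smul c f, hf] with u h h1
    rw [h, Pi.smul_apply, h1]

/-- The Hilbert space of the holomorphic representation: the closed subspace of `L²(ℂⁿ, dμ_n)`
generated by the holomorphic functions of `ū`. The element written `f(ū)` in the holomorphic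
representation is the (class of the) function `u ↦ f(ū)`. -/
noncomputable def space (n : ℕ) : Submodule ℂ (Lp ℂ 2 (gaussian n)) :=
  (antiholomorphic n).topologicalClosure

instance (n : ℕ) : CompleteSpace (space n) := by
  unfold space; infer_instance

/-! ### Polynomials in `ū` -/

lemma memLp_monomial (n : ℕ) (s : Fin n →₀ ℕ) (c : ℂ) :
    MemLp (fun u : Fin n → ℂ => MvPolynomial.eval (star u) (MvPolynomial.monomial s c)) 2
      (gaussian n) := by
  have hc : Continuous fun u : Fin n → ℂ =>
      MvPolynomial.eval (star u) (MvPolynomial.monomial s c) :=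
    (MvPolynomial.continuous_eval _).comp continuous_star
  rw [memLp_two_iff_integrable_sq_norm hc.aestronglyMeasurable]
  have h : Integrable (fun u : Fin n → ℂ => ∏ i, ‖u i‖ ^ (2 * s i)) (gaussian n) :=
    Integrable.fintype_prod (fun i => integrable_pow_gaussian₁ (2 * s i))
  refine (h.const_mul (‖c‖ ^ 2)).congr (Filter.Eventually.of_forall fun u => ?_)
  simp only [MvPolynomial.eval_monomial, Finsupp.prod_fintype _ _ (fun _ => pow_zero _),
    Pi.star_apply, norm_mul, norm_prod, norm_pow, norm_star, mul_pow, ← Finset.prod_pow]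
  congr 1
  refine Finset.prod_congr rfl fun i _ => ?_
  rw [← pow_mul, mul_comm]

lemma memLp_poly (n : ℕ) (p : MvPolynomial (Fin n) ℂ) :
    MemLp (fun u : Fin n → ℂ => MvPolynomial.eval (star u) p) 2 (gaussian n) := by
  induction p using MvPolynomial.induction_on' with
  | monomial s c => exact memLp_monomial n s c
  | add p q hp hq => simpa only [map_add] using! hp.add hq

/-- A polynomial `p`, regarded as the element `p(ū)` of the holomorphic representation space. -/
noncomputable def ofPoly (n : ℕ) : MvPolynomial (Fin n) ℂ →ₗ[ℂ] space n where
  toFun p := ⟨(memLp_poly n p).toLp _, Submodule.le_topologicalClosure _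
    ⟨fun w => MvPolynomial.eval w p, by
      induction p using MvPolynomial.induction_on with
      | C a => simp
      | add p q hp hq => simpa only [map_add] using! hp.add hq
      | mul_X p i hp =>
        simp only [map_mul, MvPolynomial.eval_X]
        exact hp.mul (differentiable_apply i), (memLp_poly n p).coeFn_toLp⟩⟩
  map_add' p q := by
    apply Subtype.ext
    simp only [Submodule.coe_add]
    rw [← MemLp.toLp_add]
    congr 1
    ext u
    simp
  map_smul' c p := by
    apply Subtype.ext
    simp only [Submodule.coe_smul, RingHom.id_apply]
    rw [← MemLp.toLp_const_smul]
    congr 1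
    ext u
    simp [MvPolynomial.smul_eval]

lemma ofPoly_injective (n : ℕ) : Function.Injective (ofPoly n) := by
  rw [← LinearMap.ker_eq_bot, LinearMap.ker_eq_bot']
  intro p hp
  have h0 : (memLp_poly n p).toLp _ = 0 := congrArg Subtype.val hp
  have hc : Continuous fun u : Fin n → ℂ => MvPolynomial.eval (star u) p :=
    (MvPolynomial.continuous_eval _).comp continuous_star
  have h2 : (fun u : Fin n → ℂ => MvPolynomial.eval (star u) p) =ᵐ[gaussian n] 0 :=
    ((memLp_poly n p).coeFn_toLp.symm.trans (by rw [h0])).trans (Lp.coeFn_zero ℂ 2 (gaussian n))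
  have h1 := (Continuous.ae_eq_iff_eq (gaussian n) hc continuous_zero).1 h2
  refine MvPolynomial.funext fun w => ?_
  have := congrFun h1 (star w)
  simpa using this

/-! ### Creation and annihilation operators, quadratic Hamiltonians -/

/-- `a†ⱼ`, multiplication by `ūⱼ`, on polynomials in `ū`. -/
noncomputable def creation {n : ℕ} (j : Fin n) :
    Module.End ℂ (MvPolynomial (Fin n) ℂ) :=
  LinearMap.mulLeft ℂ (MvPolynomial.X j)

/-- `aⱼ = ∂/∂ūⱼ` on polynomials in `ū`. -/
noncomputable def annihilation {n : ℕ} (j : Fin n) :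
    Module.End ℂ (MvPolynomial (Fin n) ℂ) :=
  (MvPolynomial.pderiv j).toLinearMap

/-- `½ ∑ⱼₖ (Bⱼₖ a†ⱼ a†ₖ + B̄ⱼₖ aⱼ aₖ + 2 Cⱼₖ a†ⱼ aₖ)` on polynomials in `ū`. -/
noncomputable def quadraticPoly {n : ℕ} (B C : Matrix (Fin n) (Fin n) ℂ) :
    Module.End ℂ (MvPolynomial (Fin n) ℂ) :=
  (1 / 2 : ℂ) • ∑ j, ∑ k, (B j k • (creation j * creation k)
    + conj (B j k) • (annihilation j * annihilation k)
    + (2 * C j k) • (creation j * annihilation k))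

/-- The quadratic Hamiltonian `½ (a†Ba† + aB̄a + 2a†Ca)` as an unbounded operator in the
holomorphic representation space, with the polynomials in `ū` as its domain. -/
noncomputable def hamiltonian {n : ℕ} (B C : Matrix (Fin n) (Fin n) ℂ) :
    space n →ₗ.[ℂ] space n where
  domain := LinearMap.range (ofPoly n)
  toFun := ofPoly n ∘ₗ quadraticPoly B C ∘ₗ
    (LinearEquiv.ofInjective (ofPoly n) (ofPoly_injective n)).symm.toLinearMap

/-! ### Unitary groups and integral kernels -/

/-- `U t = e^{itA}` for all real `t`: the family `U` is a strongly continuous one-parameter group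
of unitary operators, and its generator (with the factor `i` taken out) is exactly `A`, domain
included: `x ∈ dom A` and `A x = y` iff `(U t x - x) / (i t) → y` as `t → 0`. -/
structure IsUnitaryGroupOf {E : Type*} [NormedAddCommGroup E] [InnerProductSpace ℂ E]
    (A : E →ₗ.[ℂ] E) (U : ℝ → (E ≃ₗᵢ[ℂ] E)) : Prop where
  map_zero : ∀ x, U 0 x = x
  map_add : ∀ s t x, U (s + t) x = U s (U t x)
  continuous : ∀ x, Continuous fun t => U t x
  generator : ∀ x y, (x, y) ∈ A.graph ↔
    Filter.Tendsto (fun t : ℝ => (Complex.I * (t : ℂ))⁻¹ • (U t x - x))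
      (nhdsWithin 0 {0}ᶜ) (nhds y)

/-- `K(ū, v)` is the integral kernel of `T` in the holomorphic representation:
`(T f)(ū) = ∫ K(ū, v) f(v̄) dμ_n(v)` for all `f`, with an absolutely convergent integral. -/
def HasKernel {n : ℕ} (T : space n → space n) (K : (Fin n → ℂ) → (Fin n → ℂ) → ℂ) : Prop :=
  ∀ f : space n,
    (∀ u, Integrable (fun v => K (star u) v * (f : Lp ℂ 2 (gaussian n)) v) (gaussian n)) ∧
    (T f : Lp ℂ 2 (gaussian n)) =ᵐ[gaussian n]
      fun u => ∫ v, K (star u) v * (f : Lp ℂ 2 (gaussian n)) v ∂(gaussian n)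

/-! ### The Bogoliubov matrices and the Gaussian kernel -/

section Matrices

variable {n : ℕ} (B C : Matrix (Fin n) (Fin n) ℂ) (t : ℝ)

/-- `𝒜 = [[-C, -B], [B̄, C̄]]`. -/
noncomputable def generatorMatrix : Matrix (Fin n ⊕ Fin n) (Fin n ⊕ Fin n) ℂ :=
  Matrix.fromBlocks (-C) (-B) (B.map conj) (C.map conj)

/-- `e^{it𝒜}`. -/
noncomputable def bogoliubov : Matrix (Fin n ⊕ Fin n) (Fin n ⊕ Fin n) ℂ :=
  NormedSpace.exp ((Complex.I * (t : ℂ)) • generatorMatrix B C)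

/-- The upper left block `Φ` of `e^{it𝒜}`. -/
noncomputable def Phi : Matrix (Fin n) (Fin n) ℂ := (bogoliubov B C t).toBlocks₁₁

/-- The upper right block `Ψ` of `e^{it𝒜}`. -/
noncomputable def Psi : Matrix (Fin n) (Fin n) ℂ := (bogoliubov B C t).toBlocks₁₂

/-- The matrix `[[A¹¹, A¹²], [A²¹, A²²]]` with `A¹¹ = Ψ̄Φ⁻¹`, `A²¹ = Φ⁻¹`, `A¹² = ᵗA²¹`,
`A²² = -Φ⁻¹Ψ`. -/
noncomputable def kernelMatrix : Matrix (Fin n ⊕ Fin n) (Fin n ⊕ Fin n) ℂ :=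
  Matrix.fromBlocks ((Psi B C t).map conj * (Phi B C t)⁻¹) ((Phi B C t)⁻¹).transpose
    (Phi B C t)⁻¹ (-((Phi B C t)⁻¹ * Psi B C t))

end Matrices

/-- The Gaussian `c · exp(½ (v w) A (v w)ᵗ)`, as a function of `w` (to be evaluated at `ū`)
and `v`. -/
noncomputable def gaussianKernel {n : ℕ} (c : ℂ)
    (A : Matrix (Fin n ⊕ Fin n) (Fin n ⊕ Fin n) ℂ) (w v : Fin n → ℂ) : ℂ :=
  c * Complex.exp (1 / 2 * (Sum.elim v w ⬝ᵥ A.mulVec (Sum.elim v w)))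

end Bargmann

/-!
The operators `e^{itH}` are found on coherent states. For `w ∈ ℂⁿ` the function `ū ↦ U(ū, w)` at
time `t` is a constant times a Gaussian `exp (½ ᵗū A²² ū + ᵗ(A²¹ w) ū)`, and on such a Gaussian the
equation `γ' = i H γ` amounts to a Riccati equation for `A²²`, a linear equation for `A²¹`, a
quadrature for `A¹¹`, and the transport equation `c' = ½ i tr (B̄ A²²) c` for the prefactor. The
first three are solved by the blocks of `e^{it𝒜}` (`hasDerivAt_outerBlock`, `hasDerivAt_inv_Phi`,
`hasDerivAt_innerBlock`), and Jacobi's formula for `det (Φ e^{itC})` identifies the prefactor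
(`sq_normalization_mul_det`).

The Gaussians are square-integrable because `e^{it𝒜}` preserves the indefinite metric `diag (1, -1)`:
this gives `A²² A²²ᴴ + Φ⁻¹ Φ⁻¹ᴴ = 1`, so `A²²` is a strict contraction (`formBound_outerBlock`).
Partial sums of the exponential series show that they lie in the domain of the closure of `H`
(`gaussVec_mem_closure`). So every coherent state has a global orbit, and the coherent states are
total by their reproducing property `⟨exp (ᵗu v̄), f⟩ = f(ū)` (`coeFn_ae_eq_inner_expVec`), which
rests on the mean value property of entire functions.

A symmetric operator whose Schrödinger equation has a total family of global solutions is
essentially self-adjoint, and the solutions extend to its unitary group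
(`IsTotalEvolution.isSelfAdjoint_closure`). Inner products of solutions are constant in time, which
makes the flow isometric; the adjoint of the operator is contained in the generator of the flow,
which is symmetric, and an operator with symmetric adjoint is essentially self-adjoint.

The kernel formula is the reproducing property again:
`(e^{itH} f)(ū) = ⟨expVec u, e^{itH} f⟩ = ⟨e^{-itH} expVec u, f⟩`, and `e^{-itH} expVec u` is the
Gaussian of time `-t`, whose conjugate is `U(ū, v)` at time `t` (`conj_gaussianKernel`).
-/

/-! ### Symmetric operators with a total family of global solutions -/

namespace Bargmann

section Abstract

variable {E : Type*} [NormedAddCommGroup E] [InnerProductSpace ℂ E]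

/-- Two solutions of `x' = i A x` with a symmetric `A` have a constant inner product. -/
lemma inner_eq_of_hasDerivAt {x y x' y' : ℝ → E}
    (hx : ∀ s, HasDerivAt x (Complex.I • x' s) s) (hy : ∀ s, HasDerivAt y (Complex.I • y' s) s)
    (h : ∀ s, ⟪x' s, y s⟫_ℂ = ⟪x s, y' s⟫_ℂ) (s t : ℝ) :
    ⟪x s, y s⟫_ℂ = ⟪x t, y t⟫_ℂ := by
  have hd : ∀ s, HasDerivAt (fun s => ⟪x s, y s⟫_ℂ) 0 s := fun s => by
    convert! (hx s).inner ℂ (hy s) using 1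
    rw [inner_smul_left, inner_smul_right, h, Complex.conj_I]
    ring
  exact is_const_of_deriv_eq_zero (fun s => (hd s).differentiableAt) (fun s => (hd s).deriv) s t

/-- The generator of a unitary group is symmetric. -/
lemma tendsto_difference_symm {U : ℝ → (E ≃ₗᵢ[ℂ] E)} (h0 : ∀ x, U 0 x = x)
    (hadd : ∀ s t x, U (s + t) x = U s (U t x)) {x y x' y' : E}
    (h : Filter.Tendsto (fun t : ℝ => (Complex.I * (t : ℂ))⁻¹ • (U t x - x))
      (nhdsWithin 0 {0}ᶜ) (nhds y))
    (h' : Filter.Tendsto (fun t : ℝ => (Complex.I * (t : ℂ))⁻¹ • (U t x' - x'))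
      (nhdsWithin 0 {0}ᶜ) (nhds y')) :
    ⟪y, x'⟫_ℂ = ⟪x, y'⟫_ℂ := by
  have hn : Filter.Tendsto (fun t : ℝ => -t) (nhdsWithin 0 {0}ᶜ) (nhdsWithin 0 {0}ᶜ) := by
    refine tendsto_nhdsWithin_iff.2 ⟨?_, ?_⟩
    · have : Filter.Tendsto (fun t : ℝ => -t) (nhds 0) (nhds (-0)) := continuous_neg.tendsto 0
      rw [neg_zero] at this
      exact this.mono_left nhdsWithin_le_nhds
    · filter_upwards [self_mem_nhdsWithin] with t ht
      simpa using ht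
  have h1 := h.inner (𝕜 := ℂ) (tendsto_const_nhds (x := x'))
  have h2 := (tendsto_const_nhds (x := x)).inner (𝕜 := ℂ) (h'.comp hn)
  refine tendsto_nhds_unique h1 (h2.congr fun t => ?_)
  have h3 : ⟪x, U (-t) x'⟫_ℂ = ⟪U t x, x'⟫_ℂ := by
    rw [← (U t).inner_map_map x, ← hadd, add_neg_cancel, h0]
  simp only [Function.comp, inner_smul_left, inner_smul_right, inner_sub_left, inner_sub_right, h3]
  simp

lemma hasDerivAt_zero_of_tendsto {f : ℝ → E} {y : E}
    (h : Filter.Tendsto (fun t : ℝ => (Complex.I * (t : ℂ))⁻¹ • (f t - f 0))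
      (nhdsWithin 0 {0}ᶜ) (nhds y)) : HasDerivAt f (Complex.I • y) 0 := by
  rw [hasDerivAt_iff_tendsto_slope]
  refine (h.const_smul Complex.I).congr fun t => ?_
  simp only [slope_def_module, sub_zero, smul_smul, mul_inv_rev, ← Complex.coe_smul,
    Complex.ofReal_inv]
  congr 1
  rw [mul_comm, mul_assoc, inv_mul_cancel₀ Complex.I_ne_zero, mul_one]

lemma tendsto_of_hasDerivAt_zero {f : ℝ → E} {y : E} (h : HasDerivAt f (Complex.I • y) 0) :
    Filter.Tendsto (fun t : ℝ => (Complex.I * (t : ℂ))⁻¹ • (f t - f 0))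
      (nhdsWithin 0 {0}ᶜ) (nhds y) := by
  rw [hasDerivAt_iff_tendsto_slope] at h
  have := h.const_smul (Complex.I⁻¹)
  rw [smul_smul, inv_mul_cancel₀ Complex.I_ne_zero, one_smul] at this
  refine this.congr fun t => ?_
  simp only [slope_def_module, sub_zero, smul_smul, mul_inv_rev, ← Complex.coe_smul,
    Complex.ofReal_inv]
  rw [mul_comm]

/-- A unitary group preserves the domain of its generator, and its orbits there solve
`x' = i A x`. -/
lemma IsUnitaryGroupOf.hasDerivAt {A : E →ₗ.[ℂ] E} {V : ℝ → (E ≃ₗᵢ[ℂ] E)}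
    (hV : IsUnitaryGroupOf A V) {x y : E} (h : (x, y) ∈ A.graph) (t : ℝ) :
    HasDerivAt (fun t => V t x) (Complex.I • V t y) t ∧ (V t x, V t y) ∈ A.graph := by
  have h1 := (hV.generator x y).1 h
  have h2 : HasDerivAt (fun s => V s x) (Complex.I • y) 0 :=
    hasDerivAt_zero_of_tendsto (by simpa [hV.map_zero] using h1)
  constructor
  · have h3 : HasDerivAt (fun s => V s x) (Complex.I • y) (t - t) := by rwa [sub_self]
    have h4 := ((V t).toContinuousLinearEquiv.toContinuousLinearMap.restrictScalars
      ℝ).hasFDerivAt.comp_hasDerivAt t (h3.comp_sub_const t t)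
    have h5 : (fun s => V s x) = fun s => V t (V (s - t) x) := by
      funext s
      rw [← hV.map_add]
      simp
    rw [h5]
    convert! h4 using 1
    simp
  · rw [hV.generator]
    refine (((V t).continuous.tendsto y).comp h1).congr fun s => ?_
    simp only [Function.comp, map_smul, map_sub, ← hV.map_add, add_comm]

variable [CompleteSpace E] {T : E →ₗ.[ℂ] E}

/-- A densely defined symmetric operator is closable. -/
lemma isClosable_of_symmetric (hd : Dense (T.domain : Set E)) (hs : T.IsFormalAdjoint T) :
    T.IsClosable :=
  LinearPMap.IsClosable.leIsClosable
    (LinearPMap.adjoint_isClosed hd).isClosable (hs.le_adjoint hd)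

/-- The graph of the adjoint, described without reference to domains. -/
lemma mem_adjoint_graph (hd : Dense (T.domain : Set E)) {x y : E} :
    (x, y) ∈ T.adjoint.graph ↔ ∀ a b, (a, b) ∈ T.graph → ⟪b, x⟫_ℂ = ⟪a, y⟫_ℂ := by
  simp [LinearPMap.adjoint_graph_eq_graph_adjoint hd, sub_eq_zero]

/-- Elements of the graph of the adjoint stay symmetric to the graph of the closure. -/
lemma inner_closure_graph (hd : Dense (T.domain : Set E)) (hs : T.IsFormalAdjoint T) {a b x y : E}
    (hab : (a, b) ∈ T.closure.graph) (hxy : (x, y) ∈ T.adjoint.graph) :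
    ⟪b, x⟫_ℂ = ⟪a, y⟫_ℂ := by
  rw [← (isClosable_of_symmetric hd hs).graph_closure_eq_closure_graph] at hab
  have hcl : IsClosed {p : E × E | ⟪p.2, x⟫_ℂ = ⟪p.1, y⟫_ℂ} :=
    isClosed_eq (by fun_prop) (by fun_prop)
  exact closure_minimal (fun p hp => (mem_adjoint_graph hd).1 hxy p.1 p.2 hp) hcl hab

lemma closure_graph_le_adjoint (hd : Dense (T.domain : Set E)) (hs : T.IsFormalAdjoint T) :
    T.closure.graph ≤ T.adjoint.graph := by
  rw [← (isClosable_of_symmetric hd hs).graph_closure_eq_closure_graph]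
  exact Submodule.topologicalClosure_minimal _
    (LinearPMap.le_graph_of_le (hs.le_adjoint hd)) (LinearPMap.adjoint_isClosed hd)

/-- If the adjoint of a symmetric operator is symmetric, it is the closure: the closed graph is its
own double orthogonal complement, taken in the Hilbert space `E ⊕ E`. -/
lemma adjoint_graph_le_closure (hd : Dense (T.domain : Set E)) (hs : T.IsFormalAdjoint T)
    (h : ∀ x y x' y', (x, y) ∈ T.adjoint.graph → (x', y') ∈ T.adjoint.graph →
      ⟪y, x'⟫_ℂ = ⟪x, y'⟫_ℂ) :
    T.adjoint.graph ≤ T.closure.graph := by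
  rintro ⟨x, y⟩ hxy
  rw [← (isClosable_of_symmetric hd hs).graph_closure_eq_closure_graph]
  let L : WithLp 2 (E × E) ≃L[ℂ] E × E := WithLp.prodContinuousLinearEquiv 2 ℂ E E
  let G : Submodule ℂ (WithLp 2 (E × E)) := T.graph.comap (L : WithLp 2 (E × E) →ₗ[ℂ] E × E)
  have hmem : WithLp.toLp 2 (x, y) ∈ Gᗮᗮ := by
    rw [Submodule.mem_orthogonal]
    intro u hu
    rw [Submodule.mem_orthogonal] at hu
    -- `u ⟂ graph T` says that the rotated pair `(u₂, -u₁)` lies in the graph of the adjoint.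
    have hu' : (u.snd, -u.fst) ∈ T.adjoint.graph := by
      rw [mem_adjoint_graph hd]
      intro a b hab
      have := hu (WithLp.toLp 2 (a, b)) hab
      simp only [WithLp.prod_inner_apply] at this
      rw [inner_neg_right, ← sub_eq_zero, sub_neg_eq_add, add_comm]
      exact this
    have := h _ _ _ _ hu' hxy
    rw [inner_neg_left] at this
    simp only [WithLp.prod_inner_apply]
    change ⟪u.fst, x⟫_ℂ + ⟪u.snd, y⟫_ℂ = 0
    rw [← this]; simp
  rw [Submodule.orthogonal_orthogonal_eq_closure] at hmem
  have h1 : L (WithLp.toLp 2 (x, y)) ∈ closure (T.graph : Set (E × E)) := by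
    refine map_mem_closure L.continuous hmem fun z hz => hz
  exact h1

/-- A curve whose coefficients along a total family have a continuous vector function as weak
derivative is differentiable: it differs from the integral of that function by a constant. -/
lemma hasDerivAt_of_weak {ι : Type*} {e : ι → E} (he : ∀ x, (∀ i, ⟪e i, x⟫_ℂ = 0) → x = 0)
    {f f' : ℝ → E} (hf' : Continuous f')
    (h : ∀ i s, HasDerivAt (fun s => ⟪e i, f s⟫_ℂ) ⟪e i, f' s⟫_ℂ s) (t : ℝ) :
    HasDerivAt f (f' t) t := by
  let g : ℝ → E := fun t => ∫ s in (0 : ℝ)..t, f' s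
  have hg : ∀ t, HasDerivAt g (f' t) t := fun t =>
    (hf'.integral_hasStrictDerivAt 0 t).hasDerivAt
  have hfg : ∀ t, f t = g t + f 0 := fun t => by
    rw [← sub_eq_zero]
    refine he _ fun i => ?_
    have hd : ∀ s, HasDerivAt (fun s => ⟪e i, f s⟫_ℂ - ⟪e i, g s⟫_ℂ) 0 s := fun s => by
      have := (hasDerivAt_const s (e i)).inner ℂ (hg s)
      rw [inner_zero_left, add_zero] at this
      simpa using! (h i s).sub this
    have h1 := is_const_of_deriv_eq_zero (fun s => (hd s).differentiableAt)
      (fun s => (hd s).deriv) t 0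
    have h2 : g 0 = 0 := intervalIntegral.integral_same
    simp only [h2, inner_zero_right, sub_zero] at h1
    rw [inner_sub_right, inner_add_right, ← h1]
    ring
  rw [funext hfg]
  exact (hg t).add_const _

/-- A total family of solutions `γ i : ℝ → E` of `γ' = i T̄ γ`, where `T̄` is the closure of `T`. -/
structure IsTotalEvolution (T : E →ₗ.[ℂ] E) {ι : Type*} (γ y : ι → ℝ → E) : Prop where
  mem_graph : ∀ i t, (γ i t, y i t) ∈ T.closure.graph
  hasDerivAt : ∀ i t, HasDerivAt (γ i) (Complex.I • y i t) t
  total : ∀ x, (∀ i, ⟪γ i 0, x⟫_ℂ = 0) → x = 0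

namespace IsTotalEvolution

variable {ι : Type*} {γ y : ι → ℝ → E}

/-- Conservation of inner products along the flow; it makes the flow isometric, and its adjoint
the flow backwards in time. -/
lemma inner_shift (hγ : IsTotalEvolution T γ y) (hd : Dense (T.domain : Set E))
    (hs : T.IsFormalAdjoint T) (i j : ι) (s t : ℝ) :
    ⟪γ i (t + s), γ j s⟫_ℂ = ⟪γ i t, γ j 0⟫_ℂ := by
  have := inner_eq_of_hasDerivAt (x := fun s => γ i (t + s)) (x' := fun s => y i (t + s))
    (y := γ j) (y' := y j) (fun s => (hγ.hasDerivAt i (t + s)).comp_const_add t s)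
    (hγ.hasDerivAt j) (fun s => inner_closure_graph hd hs (hγ.mem_graph i _)
      (closure_graph_le_adjoint hd hs (hγ.mem_graph j s))) s 0
  simpa using this

/-- The flow at time `t` is isometric on the span of the initial values, and extends by
density. -/
lemma exists_isometry (hγ : IsTotalEvolution T γ y) (hd : Dense (T.domain : Set E))
    (hs : T.IsFormalAdjoint T) (t : ℝ) :
    ∃ W : E →ₗᵢ[ℂ] E, ∀ i, W (γ i 0) = γ i t := by
  let L : ℝ → (ι →₀ ℂ) →ₗ[ℂ] E := fun t => Finsupp.linearCombination ℂ fun i => γ i t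
  have hdense : DenseRange (L 0) := by
    have : (LinearMap.range (L 0)).topologicalClosure = ⊤ := by
      rw [Submodule.topologicalClosure_eq_top_iff, Submodule.eq_bot_iff]
      intro x hx
      refine hγ.total x fun i => ?_
      rw [Submodule.mem_orthogonal] at hx
      exact hx _ ⟨Finsupp.single i 1, by simp [L]⟩
    exact Submodule.dense_iff_topologicalClosure_eq_top.2 this
  have hnorm : ∀ c, ‖L t c‖ = ‖L 0 c‖ := fun c => by
    have hin : ⟪L t c, L t c⟫_ℂ = ⟪L 0 c, L 0 c⟫_ℂ := by
      simp only [L, Finsupp.linearCombination_apply, Finsupp.sum, sum_inner, inner_sum,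
        inner_smul_left, inner_smul_right]
      refine Finset.sum_congr rfl fun i _ => congrArg _ (Finset.sum_congr rfl fun j _ => ?_)
      have := hγ.inner_shift hd hs j i t 0
      rw [zero_add] at this
      rw [this]
    rw [inner_self_eq_norm_sq_to_K, inner_self_eq_norm_sq_to_K] at hin
    have : ‖L t c‖ ^ 2 = ‖L 0 c‖ ^ 2 := by exact_mod_cast hin
    exact (sq_eq_sq₀ (norm_nonneg _) (norm_nonneg _)).1 this
  have hW : ∀ c, (L t).extendOfNorm (L 0) (L 0 c) = L t c := fun c =>
    LinearMap.extendOfNorm_eq hdense ⟨1, fun c => by rw [hnorm, one_mul]⟩ c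
  refine ⟨⟨((L t).extendOfNorm (L 0)).toLinearMap, fun x => ?_⟩, fun i => ?_⟩
  · refine hdense.induction_on (p := fun x => ‖(L t).extendOfNorm (L 0) x‖ = ‖x‖) x
      (isClosed_eq (by fun_prop) (by fun_prop)) fun c => ?_
    rw [hW, hnorm]
  · have := hW (Finsupp.single i 1)
    simpa [L] using this

/-- A total family of solutions of `γ' = i T̄ γ` extends to a one-parameter unitary group. -/
lemma exists_group (hγ : IsTotalEvolution T γ y) (hd : Dense (T.domain : Set E))
    (hs : T.IsFormalAdjoint T) :
    ∃ U : ℝ → (E ≃ₗᵢ[ℂ] E), (∀ i t, U t (γ i 0) = γ i t) ∧ (∀ x, U 0 x = x) ∧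
      (∀ s t x, U (s + t) x = U s (U t x)) ∧ (∀ x, Continuous fun t => U t x) := by
  choose W hW using hγ.exists_isometry hd hs
  -- Vectors are tested against the total family; the group law and the surjectivity then follow
  -- from `inner_shift`, which identifies the adjoint of `W (-t)` with `W t`.
  have hdense : Dense (Submodule.span ℂ (Set.range fun i => γ i 0) : Set E) := by
    rw [Submodule.dense_iff_topologicalClosure_eq_top, Submodule.topologicalClosure_eq_top_iff,
      Submodule.eq_bot_iff]
    intro x hx
    refine hγ.total x fun i => ?_
    rw [Submodule.mem_orthogonal] at hx
    exact hx _ (Submodule.subset_span ⟨i, rfl⟩)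
  have hext : ∀ f g : E →L[ℂ] E, (∀ i, f (γ i 0) = g (γ i 0)) → f = g := fun f g h =>
    ContinuousLinearMap.ext_on hdense (by rintro _ ⟨i, rfl⟩; exact h i)
  have hadj : ∀ t x z, ⟪W (-t) x, z⟫_ℂ = ⟪x, W t z⟫_ℂ := fun t x z => by
    have : ((W (-t)).toContinuousLinearMap).adjoint = (W t).toContinuousLinearMap := by
      refine hext _ _ fun j => ?_
      rw [← sub_eq_zero]
      refine hγ.total _ fun i => ?_
      rw [inner_sub_right, ContinuousLinearMap.adjoint_inner_right]
      have h1 := hγ.inner_shift hd hs i j t (-t)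
      simp only [LinearIsometry.coe_toContinuousLinearMap, hW]
      rw [← h1, neg_add_cancel, sub_self]
    have h2 := congrArg (fun f : E →L[ℂ] E => ⟪x, f z⟫_ℂ) this
    simp only [ContinuousLinearMap.adjoint_inner_right] at h2
    exact h2
  have hinv : ∀ t x, W t (W (-t) x) = x := fun t x => by
    rw [← sub_eq_zero]
    refine hγ.total _ fun i => ?_
    rw [inner_sub_right, ← hadj, LinearIsometry.inner_map_map, sub_self]
  refine ⟨fun t => LinearIsometryEquiv.ofSurjective (W t) fun x => ⟨_, hinv t x⟩, ?_, ?_, ?_, ?_⟩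
  · intro i t
    exact hW t i
  · intro x
    have : (W 0).toContinuousLinearMap = ContinuousLinearMap.id ℂ E := hext _ _ fun i => hW 0 i
    exact congrArg (fun f : E →L[ℂ] E => f x) this
  · intro s t x
    have : (W (s + t)).toContinuousLinearMap =
        (W s).toContinuousLinearMap ∘L (W t).toContinuousLinearMap := by
      refine hext _ _ fun j => ?_
      rw [← sub_eq_zero]
      refine hγ.total _ fun i => ?_
      simp only [LinearIsometry.coe_toContinuousLinearMap, hW, ContinuousLinearMap.comp_apply]
      rw [inner_sub_right, ← hadj, hW]
      have h1 := hγ.inner_shift hd hs i j (s + t) (-(s + t))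
      have h2 := hγ.inner_shift hd hs i j t (-(s + t))
      rw [neg_add_cancel] at h1
      rw [show -(s + t) + t = -s by ring] at h2
      rw [h1, h2, sub_self]
    exact congrArg (fun f : E →L[ℂ] E => f x) this
  · intro x
    change Continuous fun t => W t x
    have hcl : IsClosed {x : E | Continuous fun t => W t x} := by
      refine isClosed_of_closure_subset fun x hx => ?_
      rw [Set.mem_ofPred_eq]
      refine continuous_of_uniform_approx_of_continuous fun u hu => ?_
      obtain ⟨ε, hε, hεu⟩ := Metric.mem_uniformity_dist.1 hu
      obtain ⟨z, hz, hxz⟩ := Metric.mem_closure_iff.1 hx ε hε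
      refine ⟨fun t => W t z, hz, fun t => hεu ?_⟩
      rwa [LinearIsometry.dist_map]
    have hspan : Submodule.span ℂ (Set.range fun i => γ i 0) ≤
        { carrier := {x : E | Continuous fun t => W t x}
          add_mem' := fun {a b} ha hb => by
            simpa only [Set.mem_ofPred_eq, map_add] using! Continuous.add ha hb
          zero_mem' := by simpa using continuous_const
          smul_mem' := fun c a ha => by
            simpa only [Set.mem_ofPred_eq, map_smul] using! Continuous.const_smul ha c } := by
      rw [Submodule.span_le]
      rintro _ ⟨i, rfl⟩
      change Continuous fun t => W t (γ i 0)
      simp only [hW]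
      exact continuous_iff_continuousAt.2 fun t => (hγ.hasDerivAt i t).continuousAt
    exact hcl.closure_subset_iff.2 hspan (hdense x)

/-- The adjoint of `T` is contained in the generator of the group. The derivative of `U t x` is
found weakly, by testing against the vectors `γ i 0`. -/
lemma hasDerivAt_group (hγ : IsTotalEvolution T γ y) (hd : Dense (T.domain : Set E))
    (hs : T.IsFormalAdjoint T) {U : ℝ → (E ≃ₗᵢ[ℂ] E)} (hU : ∀ i t, U t (γ i 0) = γ i t)
    (h0 : ∀ x, U 0 x = x) (hadd : ∀ s t x, U (s + t) x = U s (U t x))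
    (hc : ∀ x, Continuous fun t => U t x) {x z : E} (hxz : (x, z) ∈ T.adjoint.graph) (t : ℝ) :
    HasDerivAt (fun t => U t x) (Complex.I • U t z) t := by
  refine hasDerivAt_of_weak (f' := fun t => Complex.I • U t z) hγ.total
    ((hc z).const_smul _) (fun i s => ?_) t
  have hin : ∀ s x, ⟪γ i 0, U s x⟫_ℂ = ⟪γ i (-s), x⟫_ℂ := fun s x => by
    rw [← hU i (-s), ← (U s).inner_map_map (U (-s) _), ← hadd, add_neg_cancel, h0]
  simp only [inner_smul_right, hin]
  have h1 : HasDerivAt (fun s => γ i (-s)) (-(Complex.I • y i (-s))) s := by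
    simpa using! (hγ.hasDerivAt i (-s)).scomp s (hasDerivAt_neg s)
  have h2 := h1.inner ℂ (hasDerivAt_const s x)
  convert! h2 using 1
  rw [inner_zero_right, inner_neg_left, inner_smul_left,
    inner_closure_graph hd hs (hγ.mem_graph i (-s)) hxz]
  simp

/-- If the equation `γ' = i T̄ γ` has a total family of global solutions, then `T` is essentially
self-adjoint, and its closure generates a unique unitary group. -/
theorem isSelfAdjoint_closure (hγ : IsTotalEvolution T γ y) (hd : Dense (T.domain : Set E))
    (hs : T.IsFormalAdjoint T) :
    IsSelfAdjoint T.closure ∧ ∃ U : ℝ → (E ≃ₗᵢ[ℂ] E), IsUnitaryGroupOf T.closure U ∧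
      (∀ V, IsUnitaryGroupOf T.closure V → V = U) ∧ ∀ i t, U t (γ i 0) = γ i t := by
  obtain ⟨U, hU, h0, hadd, hc⟩ := hγ.exists_group hd hs
  have hgen : ∀ x z, (x, z) ∈ T.adjoint.graph →
      Filter.Tendsto (fun t : ℝ => (Complex.I * (t : ℂ))⁻¹ • (U t x - x))
        (nhdsWithin 0 {0}ᶜ) (nhds z) := fun x z h => by
    have := hγ.hasDerivAt_group hd hs hU h0 hadd hc h 0
    rw [h0] at this
    simpa [h0] using tendsto_of_hasDerivAt_zero this
  have hle : T.adjoint.graph ≤ T.closure.graph :=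
    adjoint_graph_le_closure hd hs fun x y x' y' h h' =>
      tendsto_difference_symm h0 hadd (hgen _ _ h) (hgen _ _ h')
  have heq : T.closure = T.adjoint :=
    LinearPMap.eq_of_eq_graph (le_antisymm (closure_graph_le_adjoint hd hs) hle)
  have hdc : Dense (T.closure.domain : Set E) := hd.mono (LinearPMap.le_closure T).1
  have hsa : T.closure.adjoint = T.closure := by
    refine LinearPMap.eq_of_eq_graph (le_antisymm ?_ ?_)
    · rintro ⟨x, z⟩ h
      refine hle ((mem_adjoint_graph hd).2 fun a b hab => (mem_adjoint_graph hdc).1 h a b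
        (LinearPMap.le_graph_of_le (LinearPMap.le_closure T) hab))
    · rintro ⟨x, z⟩ h
      exact (mem_adjoint_graph hdc).2 fun a b hab =>
        inner_closure_graph hd hs hab (closure_graph_le_adjoint hd hs h)
  have hgroup : IsUnitaryGroupOf T.closure U := by
    refine ⟨h0, hadd, hc, fun x z => ⟨fun h => hgen x z (heq ▸ h), fun h => ?_⟩⟩
    rw [heq, mem_adjoint_graph hd]
    intro a b hab
    exact tendsto_difference_symm h0 hadd
      (hgen a b (LinearPMap.le_graph_of_le (hs.le_adjoint hd) hab)) h
  refine ⟨hsa, U, hgroup, fun V hV => ?_, hU⟩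
  funext t
  have hVU : ∀ x ∈ T.closure.domain, V t x = U t x := fun x hx => by
    obtain ⟨z, hz⟩ : ∃ z, (x, z) ∈ T.closure.graph := by
      simpa [LinearPMap.mem_graph_iff] using hx
    have hin : ∀ i, ⟪γ i t, V t x⟫_ℂ = ⟪γ i 0, x⟫_ℂ := fun i => by
      have := inner_eq_of_hasDerivAt (hγ.hasDerivAt i)
        (fun s => (hV.hasDerivAt hz s).1) (fun s => inner_closure_graph hd hs (hγ.mem_graph i s)
          (closure_graph_le_adjoint hd hs (hV.hasDerivAt hz s).2)) t 0
      simpa [hV.map_zero] using this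
    have : (U t).symm (V t x) - x = 0 := hγ.total _ fun i => by
      rw [inner_sub_right, ← (U t).inner_map_map (γ i 0), LinearIsometryEquiv.apply_symm_apply,
        hU, hin, sub_self]
    rw [sub_eq_zero] at this
    rw [← this, LinearIsometryEquiv.apply_symm_apply]
    rw [this]
  ext x
  exact congrFun (Continuous.ext_on hdc (V t).continuous (U t).continuous hVU) x

end IsTotalEvolution

end Abstract

end Bargmann

/-! ### The Gaussian measure and the mean value property -/

namespace Bargmann

variable {n : ℕ}

/-- The density of `gaussian n` with respect to Lebesgue measure. -/
noncomputable def density (u : Fin n → ℂ) : ℝ := ∏ i, (Real.exp (-‖u i‖ ^ 2) / Real.pi)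

lemma density_nonneg (u : Fin n → ℂ) : 0 ≤ density u :=
  Finset.prod_nonneg fun _ _ => by positivity

lemma measurable_density_pi : Measurable (density (n := n)) := by
  unfold density; fun_prop

lemma gaussian_eq_withDensity (n : ℕ) :
    gaussian n = (volume : Measure (Fin n → ℂ)).withDensity fun u => ENNReal.ofReal (density u) := by
  have hint : Integrable (fun z : ℂ => Real.exp (-‖z‖ ^ 2) / Real.pi) volume := by
    simpa using (integrable_pow_mul_exp 0).div_const Real.pi
  refine Measure.pi_eq fun s hs => ?_
  rw [withDensity_apply _ (MeasurableSet.univ_pi hs), volume_pi, Measure.restrict_pi_pi,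
    ← ofReal_integral_eq_lintegral_ofReal]
  · simp only [density]
    rw [integral_fintype_prod_eq_prod (μ := fun i => (volume : Measure ℂ).restrict (s i))
      (fun _ z => Real.exp (-‖z‖ ^ 2) / Real.pi), ENNReal.ofReal_prod_of_nonneg
      (fun i _ => integral_nonneg fun z => by positivity)]
    refine Finset.prod_congr rfl fun i _ => ?_
    rw [gaussian₁, withDensity_apply _ (hs i), ← ofReal_integral_eq_lintegral_ofReal
      hint.integrableOn (Filter.Eventually.of_forall fun z => by positivity)]
  · exact Integrable.fintype_prod (μ := fun i => (volume : Measure ℂ).restrict (s i))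
      fun i => hint.integrableOn
  · exact Filter.Eventually.of_forall density_nonneg

lemma integral_gaussian (F : (Fin n → ℂ) → ℂ) :
    ∫ u, F u ∂(gaussian n) = ∫ u, (density u : ℂ) * F u := by
  rw [gaussian_eq_withDensity, integral_withDensity_eq_integral_toReal_smul
    measurable_density_pi.ennreal_ofReal (Filter.Eventually.of_forall fun _ => ENNReal.ofReal_lt_top)]
  simp only [ENNReal.toReal_ofReal (density_nonneg _), Complex.real_smul]

lemma integrable_gaussian_iff (F : (Fin n → ℂ) → ℂ) :
    Integrable F (gaussian n) ↔ Integrable (fun u => (density u : ℂ) * F u) := by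
  rw [gaussian_eq_withDensity, integrable_withDensity_iff_integrable_smul'
    measurable_density_pi.ennreal_ofReal (Filter.Eventually.of_forall fun _ => ENNReal.ofReal_lt_top)]
  simp only [ENNReal.toReal_ofReal (density_nonneg _), Complex.real_smul]

instance : IsProbabilityMeasure gaussian₁ := by
  constructor
  have hint : Integrable (fun z : ℂ => Real.exp (-‖z‖ ^ 2) / Real.pi) volume := by
    simpa using (integrable_pow_mul_exp 0).div_const Real.pi
  rw [gaussian₁, withDensity_apply _ MeasurableSet.univ, Measure.restrict_univ,
    ← ofReal_integral_eq_lintegral_ofReal hint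
      (Filter.Eventually.of_forall fun z => by positivity), integral_div]
  have h := Complex.integral_exp_neg_rpow (p := 2) (by norm_num)
  norm_num at h
  rw [h, div_self Real.pi_ne_zero, ENNReal.ofReal_one]

instance : IsProbabilityMeasure (gaussian n) := by
  unfold gaussian; infer_instance

lemma measurePreserving_rotation {z : ℂ} (hz : ‖z‖ = 1) :
    MeasurePreserving (fun u : Fin n → ℂ => z • u) (gaussian n) (gaussian n) := by
  suffices h : MeasurePreserving (fun w : ℂ => z * w) gaussian₁ gaussian₁ from
    measurePreserving_pi _ _ fun _ => h
  refine ⟨by fun_prop, ?_⟩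
  have hv : MeasurePreserving (fun w : ℂ => z * w) volume volume :=
    (rotation ⟨z, by simpa [Submonoid.unitSphere] using hz⟩).measurePreserving
  ext s hs
  rw [Measure.map_apply (by fun_prop) hs, gaussian₁, withDensity_apply _ hs,
    withDensity_apply _ (hs.preimage (by fun_prop)),
    ← hv.setLIntegral_comp_preimage hs measurable_density]
  simp [hz]

/-- The mean value property over `ℂⁿ`: the Gaussian measure is invariant under rotations, and the
mean of an entire function over a circle is its value at the centre. -/
lemma integral_entire {F : (Fin n → ℂ) → ℂ} (hF : Differentiable ℂ F)
    (hi : Integrable (fun u => F (star u)) (gaussian n)) :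
    ∫ u, F (star u) ∂(gaussian n) = F 0 := by
  have hmean : ∀ w : Fin n → ℂ, (2 * Real.pi)⁻¹ • ∫ θ in (0 : ℝ)..2 * Real.pi,
      F (circleMap 0 1 θ • w) = F 0 := fun w => by
    have hd : Differentiable ℂ fun z : ℂ => F (z • w) := hF.comp (by fun_prop)
    have := DiffContOnCl.circleAverage (f := fun z : ℂ => F (z • w)) (c := 0) (R := 1)
      hd.diffContOnCl
    rwa [Real.circleAverage_def, zero_smul] at this
  have hrot : ∀ θ : ℝ, MeasurePreserving (fun u : Fin n → ℂ => star (circleMap 0 1 θ) • u)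
      (gaussian n) (gaussian n) := fun θ => measurePreserving_rotation (by simp)
  have hstar : ∀ (θ : ℝ) (u : Fin n → ℂ),
      circleMap 0 1 θ • star u = star (star (circleMap 0 1 θ) • u) := fun θ u => by
    rw [star_smul, star_star]
  have hemb : ∀ θ : ℝ, MeasurableEmbedding (fun u : Fin n → ℂ => star (circleMap 0 1 θ) • u) :=
    fun θ => (Homeomorph.smulOfNeZero (star (circleMap 0 1 θ))
      (star_ne_zero.2 (circleMap_ne_center one_ne_zero))).measurableEmbedding
  have hθ : ∀ θ : ℝ, ∫ u, F (circleMap 0 1 θ • star u) ∂(gaussian n) =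
      ∫ u, F (star u) ∂(gaussian n) := fun θ => by
    simp only [hstar]
    exact (hrot θ).integral_comp (hemb θ) fun u => F (star u)
  have hprod : Integrable (Function.uncurry fun (θ : ℝ) (u : Fin n → ℂ) =>
      F (circleMap 0 1 θ • star u))
      ((volume.restrict (Set.uIoc 0 (2 * Real.pi))).prod (gaussian n)) := by
    have hc : Continuous (Function.uncurry fun (θ : ℝ) (u : Fin n → ℂ) =>
        F (circleMap 0 1 θ • star u)) := by
      have := hF.continuous
      have h2 := continuous_circleMap 0 1
      refine this.comp ?_
      fun_prop
    have : IsFiniteMeasure (volume.restrict (Set.uIoc 0 (2 * Real.pi))) := by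
      rw [Set.uIoc_of_le (by positivity)]
      infer_instance
    rw [integrable_prod_iff hc.aestronglyMeasurable]
    refine ⟨Filter.Eventually.of_forall fun θ => ?_, ?_⟩
    · simp only [Function.uncurry, hstar]
      exact (hrot θ).integrable_comp_of_integrable hi
    · have : ∀ θ : ℝ, ∫ u, ‖F (circleMap 0 1 θ • star u)‖ ∂(gaussian n) =
          ∫ u, ‖F (star u)‖ ∂(gaussian n) := fun θ => by
        simp only [hstar]
        exact (hrot θ).integral_comp (hemb θ) fun u => ‖F (star u)‖
      simp only [Function.uncurry, this]
      exact integrable_const _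
  have key : ∫ u, ((2 * Real.pi)⁻¹ • ∫ θ in (0 : ℝ)..2 * Real.pi,
      F (circleMap 0 1 θ • star u)) ∂(gaussian n) = ∫ u, F (star u) ∂(gaussian n) := by
    rw [integral_smul, ← intervalIntegral_integral_swap hprod]
    simp only [hθ, intervalIntegral.integral_const, smul_smul, sub_zero]
    rw [inv_mul_cancel₀ (by positivity), one_smul]
  rw [← key]
  simp only [hmean]
  simp

/-- Translation by `u` turns the factor `exp (ᵗū v)` into one that is antiholomorphic in `v`. -/
lemma density_translate (u v : Fin n → ℂ) :
    (density (v + u) : ℂ) * Complex.exp (star u ⬝ᵥ (v + u)) =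
      density v * Complex.exp (-(star v ⬝ᵥ u)) := by
  simp only [density, Complex.ofReal_prod, dotProduct, Complex.exp_sum, ← Finset.prod_mul_distrib,
    ← Finset.sum_neg_distrib]
  refine Finset.prod_congr rfl fun i _ => ?_
  push_cast
  rw [div_mul_eq_mul_div, div_mul_eq_mul_div, ← Complex.exp_add, ← Complex.exp_add]
  congr 2
  rw [← Complex.conj_mul', ← Complex.conj_mul']
  simp only [Pi.add_apply, Pi.star_apply, RCLike.star_def, map_add]
  ring

/-- The reproducing property of `exp (ū · v)` for square-integrable antiholomorphic functions. -/
lemma integral_exp_mul_entire {F : (Fin n → ℂ) → ℂ} (hF : Differentiable ℂ F) (u : Fin n → ℂ)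
    (hi : Integrable (fun v => Complex.exp (star u ⬝ᵥ v) * F (star v)) (gaussian n)) :
    ∫ v, Complex.exp (star u ⬝ᵥ v) * F (star v) ∂(gaussian n) = F (star u) := by
  -- Translating by `u` turns the integrand into `G (star v)`, and `G 0 = F (star u)`.
  let G : (Fin n → ℂ) → ℂ := fun w => Complex.exp (-(w ⬝ᵥ u)) * F (w + star u)
  have hG : Differentiable ℂ G := by
    refine Differentiable.mul ?_ (hF.comp (by fun_prop))
    simp only [dotProduct]
    fun_prop
  have hshift : ∀ v, (density (v + u) : ℂ) * (Complex.exp (star u ⬝ᵥ (v + u)) * F (star (v + u))) =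
      density v * G (star v) := fun v => by
    rw [← mul_assoc, density_translate, mul_assoc, star_add]
  rw [integrable_gaussian_iff] at hi
  have h1 := integral_entire hG (by
    rw [integrable_gaussian_iff]
    simpa only [hshift] using hi.comp_add_right u)
  rw [integral_gaussian] at h1 ⊢
  rw [← integral_add_right_eq_self _ u]
  simp only [hshift]
  rw [h1]
  simp [G]

/-! ### Growth bounds and dominated convergence -/

lemma integrable_exp_sq {r : ℝ} (hr : r < 1) :
    Integrable (fun u : Fin n → ℂ => Real.exp (r * ∑ i, ‖u i‖ ^ 2)) (gaussian n) := by
  have h1 : Integrable (fun z : ℂ => Real.exp (r * ‖z‖ ^ 2)) gaussian₁ := by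
    rw [gaussian₁, integrable_withDensity_iff measurable_density
      (Filter.Eventually.of_forall fun _ => ENNReal.ofReal_lt_top)]
    have h := Complex.integral_exp_neg_mul_rpow (p := 2) (b := 1 - r) (by norm_num) (by linarith)
    have h2 : Integrable (fun z : ℂ => Real.exp (-(1 - r) * ‖z‖ ^ (2 : ℝ))) volume := by
      by_contra hn
      rw [integral_undef hn] at h
      have : 0 < Real.pi * (1 - r) ^ (-2 / (2 : ℝ)) * Real.Gamma (2 / 2 + 1) := by
        have := Real.Gamma_pos_of_pos (s := (2 : ℝ) / 2 + 1) (by norm_num)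
        have := Real.rpow_pos_of_pos (sub_pos.2 hr) (-2 / (2 : ℝ))
        have := Real.pi_pos
        positivity
      linarith
    refine (h2.div_const Real.pi).congr (Filter.Eventually.of_forall fun z => ?_)
    have : 0 ≤ Real.exp (-‖z‖ ^ 2) / Real.pi := by positivity
    simp only [ENNReal.toReal_ofReal this, Real.rpow_ofNat]
    rw [mul_div_assoc', ← Real.exp_add]
    congr 2
    ring
  have h := Integrable.fintype_prod (μ := fun _ : Fin n => gaussian₁)
    (f := fun _ z => Real.exp (r * ‖z‖ ^ 2)) fun _ => h1
  refine h.congr (Filter.Eventually.of_forall fun u => ?_)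
  simp only [Finset.mul_sum, Real.exp_sum]

/-- The Gaussian bound `K exp (r |u|² / 2)`, square-integrable for `r < 1`. -/
noncomputable def majorant (K r : ℝ) (u : Fin n → ℂ) : ℝ :=
  K * Real.exp (r / 2 * ∑ i, ‖u i‖ ^ 2)

lemma majorant_star (K r : ℝ) (u : Fin n → ℂ) : majorant K r (star u) = majorant K r u := by
  simp [majorant]

lemma memLp_majorant (K : ℝ) {r : ℝ} (hr : r < 1) :
    MemLp (majorant (n := n) K r) 2 (gaussian n) := by
  have hc : Continuous (majorant (n := n) K r) := by unfold majorant; fun_prop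
  rw [memLp_two_iff_integrable_sq_norm hc.aestronglyMeasurable]
  refine ((integrable_exp_sq hr).const_mul (K ^ 2)).congr (Filter.Eventually.of_forall fun u => ?_)
  simp only [majorant, Real.norm_eq_abs, sq_abs, mul_pow, ← Real.exp_nat_mul]
  congr 2
  push_cast
  ring

/-- A linear exponential and a quadratic factor are absorbed by a larger Gaussian. -/
lemma exists_majorant (b : ℝ) {r r' : ℝ} (hr : r < r') :
    ∃ K, 0 ≤ K ∧ ∀ s : ℝ, (1 + s) ^ 2 * Real.exp (b * s + r / 2 * s ^ 2) ≤
      K * Real.exp (r' / 2 * s ^ 2) := by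
  have hδ : 0 < (r' - r) / 2 := by linarith
  set δ := (r' - r) / 2 with hδ'
  refine ⟨Real.exp ((|b| + 2) ^ 2 / (4 * δ)), (Real.exp_pos _).le, fun s => ?_⟩
  have h1 : (1 + s) ^ 2 ≤ Real.exp (2 * |s|) := by
    have h2 : |1 + s| ≤ Real.exp |s| :=
      (abs_add_le 1 s).trans (by rw [abs_one, add_comm]; exact Real.add_one_le_exp _)
    calc (1 + s) ^ 2 = |1 + s| ^ 2 := (sq_abs _).symm
      _ ≤ Real.exp |s| ^ 2 := by gcongr
      _ = _ := by rw [← Real.exp_nat_mul]; norm_num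
  calc _ ≤ Real.exp (2 * |s|) * Real.exp (b * s + r / 2 * s ^ 2) := by gcongr
    _ = Real.exp (2 * |s| + (b * s + r / 2 * s ^ 2)) := (Real.exp_add _ _).symm
    _ ≤ Real.exp ((|b| + 2) ^ 2 / (4 * δ) + r' / 2 * s ^ 2) := by
      refine Real.exp_le_exp.2 ?_
      have h3 : b * s ≤ |b| * |s| := by rw [← abs_mul]; exact le_abs_self _
      have h4 : (|b| + 2) * |s| ≤ (|b| + 2) ^ 2 / (4 * δ) + δ * |s| ^ 2 := by
        have : 0 ≤ (|b| + 2 - 2 * δ * |s|) ^ 2 / (4 * δ) := by positivity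
        have h5 : (|b| + 2 - 2 * δ * |s|) ^ 2 / (4 * δ) =
          (|b| + 2) ^ 2 / (4 * δ) + δ * |s| ^ 2 - (|b| + 2) * |s| := by field_simp; ring
        linarith
      rw [sq_abs] at h4
      have h6 : r' / 2 * s ^ 2 = r / 2 * s ^ 2 + δ * s ^ 2 := by rw [hδ']; ring
      linarith
    _ = _ := Real.exp_add _ _

/-- Dominated convergence in `L²`. -/
lemma tendsto_toLp_of_dominated {α ι : Type*} [MeasurableSpace α] {μ : Measure α} {l : Filter ι}
    [l.IsCountablyGenerated] {f : ι → α → ℂ} {f₀ : α → ℂ} (hf : ∀ i, MemLp (f i) 2 μ)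
    (hf₀ : MemLp f₀ 2 μ) {g : α → ℝ} (hg : MemLp g 2 μ) (hb : ∀ᶠ i in l, ∀ a, ‖f i a‖ ≤ g a)
    (hb₀ : ∀ a, ‖f₀ a‖ ≤ g a) (h : ∀ a, Filter.Tendsto (fun i => f i a) l (nhds (f₀ a))) :
    Filter.Tendsto (fun i => (hf i).toLp (f i)) l (nhds (hf₀.toLp f₀)) := by
  rw [Lp.tendsto_Lp_iff_tendsto_eLpNorm'']
  have h2 : Filter.Tendsto (fun i => ∫⁻ a, ‖f i a - f₀ a‖ₑ ^ 2 ∂μ) l (nhds (∫⁻ _, 0 ∂μ)) := by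
    refine tendsto_lintegral_filter_of_dominated_convergence' (fun a => ‖2 * g a‖ₑ ^ 2)
      (Filter.Eventually.of_forall fun i =>
        (((hf i).1.sub hf₀.1).enorm.pow_const 2))
      (hb.mono fun i hi => Filter.Eventually.of_forall fun a => ?_) ?_
      (Filter.Eventually.of_forall fun a => ?_)
    · gcongr
      rw [enorm_le_iff_norm_le]
      have : 0 ≤ g a := (norm_nonneg _).trans (hi a)
      rw [Real.norm_of_nonneg (by positivity)]
      have := norm_sub_le (f i a) (f₀ a)
      linarith [hi a, hb₀ a]
    · have := (hg.const_mul 2).eLpNorm_lt_top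
      rw [eLpNorm_lt_top_iff_lintegral_rpow_enorm_lt_top (by norm_num) (by norm_num)] at this
      simpa using this.ne
    · have h1 := (h a).sub_const (f₀ a)
      rw [sub_self] at h1
      simpa using! ((ENNReal.continuous_pow 2).tendsto _).comp ((continuous_enorm.tendsto _).comp h1)
  rw [lintegral_zero] at h2
  have h3 := (ENNReal.continuous_rpow_const (y := (1 / 2 : ℝ))).tendsto 0 |>.comp h2
  rw [ENNReal.zero_rpow_of_pos (by norm_num)] at h3
  refine h3.congr fun i => ?_
  rw [eLpNorm_eq_lintegral_rpow_enorm_toReal (by norm_num) (by norm_num)]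
  simp

end Bargmann

/-! ### Gaussian vectors and their growth -/

namespace Bargmann

variable {n : ℕ}

/-- The square-integrable antiholomorphic function `u ↦ F(ū)` as an element of `space n`. -/
noncomputable def ofEntire (F : (Fin n → ℂ) → ℂ) (hF : Differentiable ℂ F)
    (hL : MemLp (fun u => F (star u)) 2 (gaussian n)) : space n :=
  ⟨hL.toLp _, Submodule.le_topologicalClosure _ ⟨F, hF, hL.coeFn_toLp⟩⟩

lemma coeFn_ofEntire {F : (Fin n → ℂ) → ℂ} (hF : Differentiable ℂ F)
    (hL : MemLp (fun u => F (star u)) 2 (gaussian n)) :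
    (ofEntire F hF hL : Lp ℂ 2 (gaussian n)) =ᵐ[gaussian n] fun u => F (star u) :=
  hL.coeFn_toLp

lemma tendsto_ofEntire {ι : Type*} {l : Filter ι} [l.IsCountablyGenerated]
    {F : ι → (Fin n → ℂ) → ℂ} {F₀ : (Fin n → ℂ) → ℂ} (hF : ∀ i, Differentiable ℂ (F i))
    (hL : ∀ i, MemLp (fun u => F i (star u)) 2 (gaussian n)) (hF₀ : Differentiable ℂ F₀)
    (hL₀ : MemLp (fun u => F₀ (star u)) 2 (gaussian n)) {K r : ℝ} (hr : r < 1)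
    (hb : ∀ᶠ i in l, ∀ w, ‖F i w‖ ≤ majorant K r w) (hb₀ : ∀ w, ‖F₀ w‖ ≤ majorant K r w)
    (h : ∀ w, Filter.Tendsto (fun i => F i w) l (nhds (F₀ w))) :
    Filter.Tendsto (fun i => ofEntire (F i) (hF i) (hL i)) l (nhds (ofEntire F₀ hF₀ hL₀)) := by
  rw [tendsto_subtype_rng]
  refine tendsto_toLp_of_dominated hL hL₀ (memLp_majorant K hr) (hb.mono fun i hi u => ?_)
    (fun u => ?_) fun u => h (star u)
  · rw [← majorant_star]; exact hi _
  · rw [← majorant_star]; exact hb₀ _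

lemma memLp_of_le_majorant {F : (Fin n → ℂ) → ℂ} (hF : Differentiable ℂ F) {K r : ℝ} (hr : r < 1)
    (hb : ∀ w, ‖F w‖ ≤ majorant K r w) : MemLp (fun u => F (star u)) 2 (gaussian n) := by
  refine (memLp_majorant K hr).mono
    (hF.continuous.comp continuous_star).aestronglyMeasurable
    (Filter.Eventually.of_forall fun u => ?_)
  rw [← majorant_star]
  exact (hb _).trans (le_abs_self _)

/-- The Euclidean norm on `ℂⁿ`. -/
noncomputable def radius (z : Fin n → ℂ) : ℝ := √(∑ i, ‖z i‖ ^ 2)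

lemma radius_nonneg (z : Fin n → ℂ) : 0 ≤ radius z := Real.sqrt_nonneg _

lemma sq_radius (z : Fin n → ℂ) : radius z ^ 2 = ∑ i, ‖z i‖ ^ 2 :=
  Real.sq_sqrt (Finset.sum_nonneg fun _ _ => by positivity)

lemma norm_le_radius (z : Fin n → ℂ) (i : Fin n) : ‖z i‖ ≤ radius z := by
  refine Real.le_sqrt_of_sq_le ?_
  exact Finset.single_le_sum (f := fun i => ‖z i‖ ^ 2) (fun _ _ => by positivity)
    (Finset.mem_univ i)

/-- The sum of the absolute values of the coefficients of the form `½ ᵗz M z + ᵗb z`. -/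
noncomputable def coeffSize (M : Matrix (Fin n) (Fin n) ℂ) (b : Fin n → ℂ) : ℝ :=
  ∑ i, ∑ j, ‖M i j‖ + ∑ i, ‖b i‖

/-- The quadratic form `½ ᵗz M z + ᵗb z`. -/
noncomputable def quadForm (M : Matrix (Fin n) (Fin n) ℂ) (b z : Fin n → ℂ) : ℂ :=
  1 / 2 * (z ⬝ᵥ M.mulVec z) + b ⬝ᵥ z

/-- The form `ᵗz M z` is bounded by `r |z|²`. For `r < 1` this makes `exp (½ ᵗū M ū)`
square-integrable. -/
def FormBound (M : Matrix (Fin n) (Fin n) ℂ) (r : ℝ) : Prop :=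
  ∀ z : Fin n → ℂ, ‖z ⬝ᵥ M.mulVec z‖ ≤ r * ∑ i, ‖z i‖ ^ 2

lemma coeffSize_nonneg (M : Matrix (Fin n) (Fin n) ℂ) (b : Fin n → ℂ) : 0 ≤ coeffSize M b := by
  unfold coeffSize; positivity

lemma norm_entry_le_coeffSize (M : Matrix (Fin n) (Fin n) ℂ) (b : Fin n → ℂ) (i j : Fin n) :
    ‖M i j‖ ≤ coeffSize M b := by
  have h1 : ‖M i j‖ ≤ ∑ j, ‖M i j‖ :=
    Finset.single_le_sum (f := fun j => ‖M i j‖) (fun _ _ => norm_nonneg _) (Finset.mem_univ j)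
  have h2 : ∑ j, ‖M i j‖ ≤ ∑ i, ∑ j, ‖M i j‖ :=
    Finset.single_le_sum (f := fun i => ∑ j, ‖M i j‖) (fun _ _ => by positivity)
      (Finset.mem_univ i)
  have h3 : 0 ≤ ∑ i, ‖b i‖ := by positivity
  unfold coeffSize
  linarith

lemma norm_mulVec_add_le (M : Matrix (Fin n) (Fin n) ℂ) (b z : Fin n → ℂ) (i : Fin n) :
    ‖(M.mulVec z + b) i‖ ≤ coeffSize M b * (1 + radius z) := by
  have h0 := radius_nonneg z
  have h1 : ‖M.mulVec z i‖ ≤ (∑ i, ∑ j, ‖M i j‖) * radius z := by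
    calc ‖M.mulVec z i‖ ≤ ∑ j, ‖M i j‖ * ‖z j‖ := by
          simp only [Matrix.mulVec, dotProduct, ← norm_mul]
          exact norm_sum_le _ _
      _ ≤ ∑ j, ‖M i j‖ * radius z := by
          gcongr with j; exact norm_le_radius z j
      _ = (∑ j, ‖M i j‖) * radius z := by rw [Finset.sum_mul]
      _ ≤ _ := mul_le_mul_of_nonneg_right (Finset.single_le_sum (f := fun i => ∑ j, ‖M i j‖)
            (fun _ _ => by positivity) (Finset.mem_univ i)) h0
  have h2 : ‖b i‖ ≤ ∑ i, ‖b i‖ :=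
    Finset.single_le_sum (f := fun i => ‖b i‖) (fun _ _ => norm_nonneg _) (Finset.mem_univ i)
  have h3 : 0 ≤ ∑ i, ∑ j, ‖M i j‖ := by positivity
  have h4 : 0 ≤ ∑ i, ‖b i‖ := by positivity
  refine (norm_add_le _ _).trans ?_
  unfold coeffSize
  nlinarith [mul_nonneg h4 h0]

lemma norm_quadForm_le {M : Matrix (Fin n) (Fin n) ℂ} {r : ℝ} (hM : FormBound M r)
    (b z : Fin n → ℂ) : ‖quadForm M b z‖ ≤ coeffSize M b * radius z + r / 2 * radius z ^ 2 := by
  have h1 : ‖b ⬝ᵥ z‖ ≤ (∑ i, ‖b i‖) * radius z := by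
    rw [Finset.sum_mul]
    refine (norm_sum_le _ _).trans (Finset.sum_le_sum fun i _ => ?_)
    rw [norm_mul]
    gcongr
    exact norm_le_radius z i
  have h2 := hM z
  rw [← sq_radius] at h2
  have h3 : 0 ≤ ∑ i, ∑ j, ‖M i j‖ := by positivity
  have h4 := mul_nonneg h3 (radius_nonneg z)
  refine (norm_add_le _ _).trans ?_
  rw [norm_mul]
  norm_num
  unfold coeffSize
  linarith

/-- The quadratic Hamiltonian applied to `exp (½ ᵗz M z + ᵗb z)`, where in the terms that come from
differentiating the exponential zero, one or two times it is replaced by `e₀`, `e₁`, `e₂`. With the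
exponential itself for all three, this is the image of the Gaussian; with partial sums of its
series, whose derivative is the preceding partial sum, it is the image of an approximating
polynomial. -/
noncomputable def symbol (B C M : Matrix (Fin n) (Fin n) ℂ) (b z : Fin n → ℂ) (e₀ e₁ e₂ : ℂ) : ℂ :=
  1 / 2 * ∑ j, ∑ k, (B j k * (z j * z k * e₀)
    + conj (B j k) * ((M.mulVec z + b) j * (M.mulVec z + b) k * e₂ + M j k * e₁)
    + 2 * C j k * (z j * (M.mulVec z + b) k * e₁))

lemma norm_symbol_le (B C M : Matrix (Fin n) (Fin n) ℂ) (b z : Fin n → ℂ) {e₀ e₁ e₂ : ℂ} {e : ℝ}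
    (h0 : ‖e₀‖ ≤ e) (h1 : ‖e₁‖ ≤ e) (h2 : ‖e₂‖ ≤ e) :
    ‖symbol B C M b z e₀ e₁ e₂‖ ≤
      (∑ j, ∑ k, (‖B j k‖ + ‖C j k‖)) * (1 + coeffSize M b) ^ 2 * ((1 + radius z) ^ 2 * e) := by
  set m := coeffSize M b with hm
  set s := radius z with hs
  have hm0 : 0 ≤ m := coeffSize_nonneg M b
  have hs0 : 0 ≤ s := radius_nonneg z
  have he : 0 ≤ e := (norm_nonneg _).trans h0
  have hl : ∀ j, ‖(M.mulVec z + b) j‖ ≤ m * (1 + s) := norm_mulVec_add_le M b z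
  have hz : ∀ j, ‖z j‖ ≤ s := norm_le_radius z
  have hM : ∀ j k, ‖M j k‖ ≤ m := norm_entry_le_coeffSize M b
  unfold symbol
  rw [norm_mul]
  have hterm : ∀ j k, ‖B j k * (z j * z k * e₀)
      + conj (B j k) * ((M.mulVec z + b) j * (M.mulVec z + b) k * e₂ + M j k * e₁)
      + 2 * C j k * (z j * (M.mulVec z + b) k * e₁)‖ ≤
      2 * ((‖B j k‖ + ‖C j k‖) * (1 + m) ^ 2 * ((1 + s) ^ 2 * e)) := fun j k => by
    have t1 : ‖z j * z k * e₀‖ ≤ s * s * e := by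
      rw [norm_mul, norm_mul]; gcongr <;> exact hz _
    have t2 : ‖(M.mulVec z + b) j * (M.mulVec z + b) k * e₂ + M j k * e₁‖ ≤
        (m * (1 + s)) * (m * (1 + s)) * e + m * e := by
      refine (norm_add_le _ _).trans ?_
      rw [norm_mul, norm_mul, norm_mul]
      gcongr <;> first | exact hl _ | exact hM _ _
    have t3 : ‖z j * (M.mulVec z + b) k * e₁‖ ≤ s * (m * (1 + s)) * e := by
      rw [norm_mul, norm_mul]; gcongr <;> first | exact hz _ | exact hl _
    refine (norm_add₃_le ..).trans ?_
    rw [norm_mul (B j k), norm_mul (conj (B j k)), norm_mul (2 * C j k), RCLike.norm_conj,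
      norm_mul 2]
    have hB := norm_nonneg (B j k)
    have hC := norm_nonneg (C j k)
    have u1 : s * s * e + ((m * (1 + s)) * (m * (1 + s)) * e + m * e) ≤
        2 * ((1 + m) ^ 2 * ((1 + s) ^ 2 * e)) := by
      have : 0 ≤ e * (2 * ((1 + m) ^ 2 * (1 + s) ^ 2) -
          (s * s + (m * (1 + s)) * (m * (1 + s)) + m)) := by
        refine mul_nonneg he ?_
        have : 2 * ((1 + m) ^ 2 * (1 + s) ^ 2) - (s * s + (m * (1 + s)) * (m * (1 + s)) + m) =
          2 + 4 * s + s ^ 2 + 3 * m + 8 * m * s + 4 * m * s ^ 2 + m ^ 2 + 2 * m ^ 2 * s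
            + m ^ 2 * s ^ 2 := by ring
        rw [this]; positivity
      linarith
    have u2 : s * (m * (1 + s)) * e ≤ (1 + m) ^ 2 * ((1 + s) ^ 2 * e) := by
      have : 0 ≤ e * ((1 + m) ^ 2 * (1 + s) ^ 2 - s * (m * (1 + s))) := by
        refine mul_nonneg he ?_
        have : (1 + m) ^ 2 * (1 + s) ^ 2 - s * (m * (1 + s)) =
          1 + 2 * s + s ^ 2 + 2 * m + 3 * m * s + m * s ^ 2 + m ^ 2 + 2 * m ^ 2 * s
            + m ^ 2 * s ^ 2 := by ring
        rw [this]; positivity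
      linarith
    have n2 : ‖(2 : ℂ)‖ = 2 := by norm_num
    rw [n2]
    calc _ ≤ ‖B j k‖ * (s * s * e) + ‖B j k‖ * ((m * (1 + s)) * (m * (1 + s)) * e + m * e)
          + 2 * ‖C j k‖ * (s * (m * (1 + s)) * e) := by gcongr
      _ = ‖B j k‖ * (s * s * e + ((m * (1 + s)) * (m * (1 + s)) * e + m * e))
          + 2 * ‖C j k‖ * (s * (m * (1 + s)) * e) := by ring
      _ ≤ ‖B j k‖ * (2 * ((1 + m) ^ 2 * ((1 + s) ^ 2 * e)))
          + 2 * ‖C j k‖ * ((1 + m) ^ 2 * ((1 + s) ^ 2 * e)) := by gcongr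
      _ = _ := by ring
  have hsum := (norm_sum_le Finset.univ fun j => ∑ k, (B j k * (z j * z k * e₀)
      + conj (B j k) * ((M.mulVec z + b) j * (M.mulVec z + b) k * e₂ + M j k * e₁)
      + 2 * C j k * (z j * (M.mulVec z + b) k * e₁))).trans
    (Finset.sum_le_sum fun j _ => (norm_sum_le _ _).trans (Finset.sum_le_sum fun k _ => hterm j k))
  simp only [← Finset.mul_sum, ← Finset.sum_mul] at hsum
  have hhalf : ‖(1 / 2 : ℂ)‖ = 1 / 2 := by norm_num
  rw [hhalf]
  linarith

/-! ### The Hamiltonian on Gaussian vectors -/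

lemma differentiable_quadForm (M : Matrix (Fin n) (Fin n) ℂ) (b : Fin n → ℂ) :
    Differentiable ℂ (quadForm M b) := by
  unfold quadForm
  simp only [dotProduct, Matrix.mulVec]
  fun_prop

lemma differentiable_symbol_exp (B C M : Matrix (Fin n) (Fin n) ℂ) (b : Fin n → ℂ) :
    Differentiable ℂ fun z => symbol B C M b z (Complex.exp (quadForm M b z))
      (Complex.exp (quadForm M b z)) (Complex.exp (quadForm M b z)) := by
  have := differentiable_quadForm M b
  unfold symbol
  simp only [dotProduct, Matrix.mulVec, Pi.add_apply]
  fun_prop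

/-- A majorant for all Gaussian vectors with a given bound on the coefficients, and for their images
under the Hamiltonian. -/
lemma exists_gaussian_majorant (B C : Matrix (Fin n) (Fin n) ℂ) (m : ℝ) {r : ℝ} (hr : r < 1) :
    ∃ K r' : ℝ, r' < 1 ∧ ∀ (M : Matrix (Fin n) (Fin n) ℂ) (b : Fin n → ℂ), FormBound M r →
      coeffSize M b ≤ m → ∀ z, Real.exp ‖quadForm M b z‖ ≤ majorant K r' z ∧
        ∀ e₀ e₁ e₂ : ℂ, ‖e₀‖ ≤ Real.exp ‖quadForm M b z‖ → ‖e₁‖ ≤ Real.exp ‖quadForm M b z‖ →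
          ‖e₂‖ ≤ Real.exp ‖quadForm M b z‖ → ‖symbol B C M b z e₀ e₁ e₂‖ ≤ majorant K r' z := by
  obtain ⟨r', hr', hr1⟩ := exists_between hr
  obtain ⟨K, hK, h⟩ := exists_majorant m hr'
  set κ := ∑ j, ∑ k, (‖B j k‖ + ‖C j k‖) with hκ
  have hκ0 : 0 ≤ κ := by positivity
  refine ⟨(1 + κ * (1 + m) ^ 2) * K, r', hr1, fun M b hM hm z => ?_⟩
  have hs := radius_nonneg z
  have hm0 := coeffSize_nonneg M b
  have h1 : Real.exp ‖quadForm M b z‖ ≤ Real.exp (m * radius z + r / 2 * radius z ^ 2) := by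
    refine Real.exp_le_exp.2 ((norm_quadForm_le hM b z).trans ?_)
    gcongr
  have h2 : (1 + radius z) ^ 2 * Real.exp ‖quadForm M b z‖ ≤
      K * Real.exp (r' / 2 * radius z ^ 2) := le_trans (by gcongr) (h (radius z))
  have hE : majorant ((1 + κ * (1 + m) ^ 2) * K) r' z =
      K * Real.exp (r' / 2 * radius z ^ 2) +
        κ * (1 + m) ^ 2 * (K * Real.exp (r' / 2 * radius z ^ 2)) := by
    rw [majorant, sq_radius]; ring
  have h3 : 0 ≤ K * Real.exp (r' / 2 * radius z ^ 2) := by positivity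
  refine ⟨?_, fun e₀ e₁ e₂ he₀ he₁ he₂ => ?_⟩
  · have h4 : Real.exp ‖quadForm M b z‖ ≤ (1 + radius z) ^ 2 * Real.exp ‖quadForm M b z‖ := by
      refine le_mul_of_one_le_left (Real.exp_pos _).le ?_
      nlinarith
    rw [hE]
    have : 0 ≤ κ * (1 + m) ^ 2 * (K * Real.exp (r' / 2 * radius z ^ 2)) := by positivity
    linarith
  · refine (norm_symbol_le B C M b z he₀ he₁ he₂).trans ?_
    rw [hE]
    have : κ * (1 + coeffSize M b) ^ 2 * ((1 + radius z) ^ 2 * Real.exp ‖quadForm M b z‖) ≤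
        κ * (1 + m) ^ 2 * (K * Real.exp (r' / 2 * radius z ^ 2)) := by gcongr
    linarith

lemma memLp_gaussian {M : Matrix (Fin n) (Fin n) ℂ} {r : ℝ} (hM : FormBound M r) (hr : r < 1)
    (b : Fin n → ℂ) :
    MemLp (fun u => Complex.exp (quadForm M b (star u))) 2 (gaussian n) := by
  obtain ⟨K, r', hr', h⟩ := exists_gaussian_majorant 0 0 (coeffSize M b) hr
  exact memLp_of_le_majorant (F := fun z => Complex.exp (quadForm M b z))
    (differentiable_quadForm M b).cexp hr' fun z =>
      (Complex.norm_exp_le_exp_norm _).trans (h M b hM le_rfl z).1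

lemma memLp_symbol {M : Matrix (Fin n) (Fin n) ℂ} {r : ℝ} (hM : FormBound M r) (hr : r < 1)
    (B C : Matrix (Fin n) (Fin n) ℂ) (b : Fin n → ℂ) :
    MemLp (fun u => symbol B C M b (star u) (Complex.exp (quadForm M b (star u)))
      (Complex.exp (quadForm M b (star u))) (Complex.exp (quadForm M b (star u)))) 2
      (gaussian n) := by
  obtain ⟨K, r', hr', h⟩ := exists_gaussian_majorant B C (coeffSize M b) hr
  exact memLp_of_le_majorant (F := fun z => symbol B C M b z (Complex.exp (quadForm M b z))
      (Complex.exp (quadForm M b z)) (Complex.exp (quadForm M b z)))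
    (differentiable_symbol_exp B C M b) hr' fun z =>
      (h M b hM le_rfl z).2 _ _ _ (Complex.norm_exp_le_exp_norm _) (Complex.norm_exp_le_exp_norm _) (Complex.norm_exp_le_exp_norm _)

/-- The vector `exp (½ ᵗū M ū + ᵗb ū)`. -/
noncomputable def gaussVec {M : Matrix (Fin n) (Fin n) ℂ} {r : ℝ} (hM : FormBound M r) (hr : r < 1)
    (b : Fin n → ℂ) : space n :=
  ofEntire (fun z => Complex.exp (quadForm M b z)) (differentiable_quadForm M b).cexp
    (memLp_gaussian hM hr b)

/-- The image of `gaussVec` under the closure of the Hamiltonian. -/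
noncomputable def gaussImage {M : Matrix (Fin n) (Fin n) ℂ} {r : ℝ} (hM : FormBound M r)
    (hr : r < 1) (B C : Matrix (Fin n) (Fin n) ℂ) (b : Fin n → ℂ) : space n :=
  ofEntire (fun z => symbol B C M b z (Complex.exp (quadForm M b z))
    (Complex.exp (quadForm M b z)) (Complex.exp (quadForm M b z)))
    (differentiable_symbol_exp B C M b) (memLp_symbol hM hr B C b)

/-- `quadForm M b` as a polynomial. -/
noncomputable def quadFormPoly (M : Matrix (Fin n) (Fin n) ℂ) (b : Fin n → ℂ) :
    MvPolynomial (Fin n) ℂ :=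
  ∑ j, ∑ k, MvPolynomial.C (1 / 2 * M j k) * (MvPolynomial.X j * MvPolynomial.X k)
    + ∑ j, MvPolynomial.C (b j) * MvPolynomial.X j

lemma eval_quadFormPoly (M : Matrix (Fin n) (Fin n) ℂ) (b z : Fin n → ℂ) :
    MvPolynomial.eval z (quadFormPoly M b) = quadForm M b z := by
  simp only [quadFormPoly, quadForm, map_add, map_sum, map_mul, MvPolynomial.eval_C,
    MvPolynomial.eval_X, dotProduct, Matrix.mulVec, Finset.mul_sum]
  congr 1
  refine Finset.sum_congr rfl fun j _ => Finset.sum_congr rfl fun k _ => ?_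
  ring

lemma pderiv_quadFormPoly {M : Matrix (Fin n) (Fin n) ℂ} (hM : M.IsSymm) (b : Fin n → ℂ)
    (k : Fin n) : MvPolynomial.pderiv k (quadFormPoly M b) =
      ∑ l, MvPolynomial.C (M k l) * MvPolynomial.X l + MvPolynomial.C (b k) := by
  simp only [quadFormPoly, map_add, map_sum, MvPolynomial.pderiv_C, Derivation.leibniz,
    MvPolynomial.pderiv_X, Pi.single_apply, smul_eq_mul, mul_ite, mul_one, mul_zero, mul_add,
    Finset.sum_add_distrib, Finset.sum_ite_eq', Finset.mem_univ, if_true, add_zero]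
  congr 1
  rw [Finset.sum_comm]
  simp only [Finset.sum_ite_eq', Finset.mem_univ, if_true, ← Finset.sum_add_distrib]
  refine Finset.sum_congr rfl fun l _ => ?_
  rw [hM.apply k l, ← add_mul, ← map_add]
  congr 2
  ring

lemma pderiv_pderiv_quadFormPoly {M : Matrix (Fin n) (Fin n) ℂ} (hM : M.IsSymm) (b : Fin n → ℂ)
    (j k : Fin n) : MvPolynomial.pderiv j (MvPolynomial.pderiv k (quadFormPoly M b)) =
      MvPolynomial.C (M j k) := by
  simp [pderiv_quadFormPoly hM, MvPolynomial.pderiv_X, Pi.single_apply, hM.apply j k]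

/-- The partial sums of `exp Q`. -/
noncomputable def expSum (Q : MvPolynomial (Fin n) ℂ) (N : ℕ) : MvPolynomial (Fin n) ℂ :=
  ∑ i ∈ Finset.range N, MvPolynomial.C ((i.factorial : ℂ)⁻¹) * Q ^ i

/-- The partial sums satisfy the differential equation of the exponential with a shift of the
index. -/
lemma pderiv_expSum (Q : MvPolynomial (Fin n) ℂ) (N : ℕ) (k : Fin n) :
    MvPolynomial.pderiv k (expSum Q (N + 1)) = expSum Q N * MvPolynomial.pderiv k Q := by
  rw [expSum, Finset.sum_range_succ', map_add, map_sum, expSum, Finset.sum_mul]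
  simp only [Nat.factorial_zero, pow_zero, mul_one, MvPolynomial.pderiv_C, add_zero]
  refine Finset.sum_congr rfl fun i _ => ?_
  rw [MvPolynomial.pderiv_C_mul, MvPolynomial.pderiv_pow, Nat.add_sub_cancel,
    Nat.factorial_succ]
  have : ((i + 1 : ℕ) : MvPolynomial (Fin n) ℂ) = MvPolynomial.C ((i : ℂ) + 1) := by simp
  rw [this, ← mul_assoc, ← mul_assoc, ← map_mul]
  congr 3
  push_cast
  have h1 : (i : ℂ) + 1 ≠ 0 := Nat.cast_add_one_ne_zero i
  have h2 : (i.factorial : ℂ) ≠ 0 := Nat.cast_ne_zero.2 i.factorial_ne_zero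
  field_simp

lemma eval_expSum (Q : MvPolynomial (Fin n) ℂ) (N : ℕ) (z : Fin n → ℂ) :
    MvPolynomial.eval z (expSum Q N) =
      ∑ i ∈ Finset.range N, (MvPolynomial.eval z Q) ^ i / (i.factorial : ℂ) := by
  simp only [expSum, map_sum, map_mul, MvPolynomial.eval_C, map_pow]
  exact Finset.sum_congr rfl fun i _ => by rw [div_eq_mul_inv, mul_comm]

lemma norm_eval_expSum_le (Q : MvPolynomial (Fin n) ℂ) (N : ℕ) (z : Fin n → ℂ) :
    ‖MvPolynomial.eval z (expSum Q N)‖ ≤ Real.exp ‖MvPolynomial.eval z Q‖ := by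
  rw [eval_expSum]
  refine (norm_sum_le _ _).trans (le_trans (le_of_eq ?_)
    (Real.sum_le_exp_of_nonneg (norm_nonneg (MvPolynomial.eval z Q)) N))
  exact Finset.sum_congr rfl fun i _ => by simp

lemma tendsto_eval_expSum (Q : MvPolynomial (Fin n) ℂ) (z : Fin n → ℂ) :
    Filter.Tendsto (fun N => MvPolynomial.eval z (expSum Q N)) Filter.atTop
      (nhds (Complex.exp (MvPolynomial.eval z Q))) := by
  simp only [eval_expSum]
  rw [Complex.exp_eq_exp_ℂ]
  exact (NormedSpace.expSeries_div_hasSum_exp (MvPolynomial.eval z Q)).tendsto_sum_nat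

/-- The Hamiltonian applied to a partial sum of the Gaussian. Each differentiation lowers the
number of terms by one. -/
lemma eval_quadraticPoly_expSum (B C : Matrix (Fin n) (Fin n) ℂ) {M : Matrix (Fin n) (Fin n) ℂ}
    (hM : M.IsSymm) (b z : Fin n → ℂ) (N : ℕ) :
    MvPolynomial.eval z (quadraticPoly B C (expSum (quadFormPoly M b) (N + 2))) =
      symbol B C M b z (MvPolynomial.eval z (expSum (quadFormPoly M b) (N + 2)))
        (MvPolynomial.eval z (expSum (quadFormPoly M b) (N + 1)))
        (MvPolynomial.eval z (expSum (quadFormPoly M b) N)) := by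
  have hd : ∀ k, MvPolynomial.eval z (MvPolynomial.pderiv k (quadFormPoly M b)) =
      (M.mulVec z + b) k := fun k => by
    simp [pderiv_quadFormPoly hM, Matrix.mulVec, dotProduct]
  simp only [quadraticPoly, symbol, creation, annihilation, LinearMap.smul_apply,
    LinearMap.sum_apply, LinearMap.add_apply, Module.End.mul_apply, LinearMap.mulLeft_apply,
    Derivation.coeFn_coe, pderiv_expSum, Derivation.leibniz, MvPolynomial.smul_eval, map_sum,
    map_add, map_mul, smul_eq_mul, MvPolynomial.eval_X, hd, pderiv_pderiv_quadFormPoly hM,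
    MvPolynomial.eval_C]
  congr 1
  refine Finset.sum_congr rfl fun j _ => Finset.sum_congr rfl fun k _ => ?_
  ring

lemma ofPoly_eq_ofEntire (p : MvPolynomial (Fin n) ℂ)
    (hF : Differentiable ℂ fun w => MvPolynomial.eval w p) :
    ofPoly n p = ofEntire (fun w => MvPolynomial.eval w p) hF (memLp_poly n p) := rfl

lemma differentiable_eval (p : MvPolynomial (Fin n) ℂ) :
    Differentiable ℂ fun w => MvPolynomial.eval w p := by
  induction p using MvPolynomial.induction_on with
  | C a => simp
  | add p q hp hq => simpa only [map_add] using! hp.add hq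
  | mul_X p i hp =>
    simp only [map_mul, MvPolynomial.eval_X]
    exact hp.mul (differentiable_apply i)

lemma ofPoly_mem_graph (B C : Matrix (Fin n) (Fin n) ℂ) (p : MvPolynomial (Fin n) ℂ) :
    (ofPoly n p, ofPoly n (quadraticPoly B C p)) ∈ (hamiltonian B C).graph := by
  rw [LinearPMap.mem_graph_iff]
  refine ⟨⟨ofPoly n p, p, rfl⟩, rfl, ?_⟩
  change ofPoly n (quadraticPoly B C ((LinearEquiv.ofInjective (ofPoly n)
    (ofPoly_injective n)).symm ⟨ofPoly n p, _⟩)) = _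
  congr 2
  rw [LinearEquiv.symm_apply_eq]
  rfl

/-- Gaussian vectors are in the domain of the closure of the Hamiltonian: the exponential is
approximated by its partial sums. -/
lemma gaussVec_mem_closure (B C : Matrix (Fin n) (Fin n) ℂ) {M : Matrix (Fin n) (Fin n) ℂ}
    (hsymm : M.IsSymm) {r : ℝ} (hM : FormBound M r) (hr : r < 1) (b : Fin n → ℂ) :
    (gaussVec hM hr b, gaussImage hM hr B C b) ∈
      closure ((hamiltonian B C).graph : Set (space n × space n)) := by
  obtain ⟨K, r', hr', h⟩ := exists_gaussian_majorant B C (coeffSize M b) hr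
  set Q := quadFormPoly M b with hQ
  have hle : ∀ N z, ‖MvPolynomial.eval z (expSum Q N)‖ ≤ Real.exp ‖quadForm M b z‖ := fun N z => by
    rw [← eval_quadFormPoly]; exact norm_eval_expSum_le Q N z
  have hlim : ∀ (k : ℕ) z, Filter.Tendsto (fun N => MvPolynomial.eval z (expSum Q (N + k)))
      Filter.atTop (nhds (Complex.exp (quadForm M b z))) := fun k z => by
    rw [← eval_quadFormPoly]
    exact (tendsto_eval_expSum Q z).comp (Filter.tendsto_add_atTop_nat k)
  refine mem_closure_of_tendsto (b := Filter.atTop) (f := fun N : ℕ =>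
    (ofPoly n (expSum Q (N + 2)), ofPoly n (quadraticPoly B C (expSum Q (N + 2)))))
    (Filter.Tendsto.prodMk_nhds ?_ ?_)
    (Filter.Eventually.of_forall fun N => ofPoly_mem_graph B C _)
  · simp only [ofPoly_eq_ofEntire _ (differentiable_eval _)]
    exact tendsto_ofEntire (F := fun N z => MvPolynomial.eval z (expSum Q (N + 2)))
      (F₀ := fun z => Complex.exp (quadForm M b z)) _ _ _ _ hr'
      (Filter.Eventually.of_forall fun N z => (hle _ z).trans (h M b hM le_rfl z).1)
      (fun z => (Complex.norm_exp_le_exp_norm _).trans (h M b hM le_rfl z).1) (hlim 2)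
  · simp only [ofPoly_eq_ofEntire _ (differentiable_eval _)]
    refine tendsto_ofEntire
      (F := fun N z => MvPolynomial.eval z (quadraticPoly B C (expSum Q (N + 2))))
      (F₀ := fun z => symbol B C M b z (Complex.exp (quadForm M b z))
        (Complex.exp (quadForm M b z)) (Complex.exp (quadForm M b z))) _ _ _ _ hr'
      (Filter.Eventually.of_forall fun N z => ?_)
      (fun z => (h M b hM le_rfl z).2 _ _ _ (Complex.norm_exp_le_exp_norm _) (Complex.norm_exp_le_exp_norm _) (Complex.norm_exp_le_exp_norm _))
      fun z => ?_
    · rw [hQ, eval_quadraticPoly_expSum B C hsymm]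
      exact (h M b hM le_rfl z).2 _ _ _ (hle _ z) (hle _ z) (hle _ z)
    · simp only [hQ, eval_quadraticPoly_expSum B C hsymm]
      have h0 := hlim 0 z
      have h1 := hlim 1 z
      have h2 := hlim 2 z
      have hc : Continuous fun e : ℂ × ℂ × ℂ => symbol B C M b z e.1 e.2.1 e.2.2 := by
        unfold symbol; fun_prop
      set E := Complex.exp (quadForm M b z)
      have h3 := (hc.tendsto (E, E, E)).comp (h2.prodMk_nhds (h1.prodMk_nhds h0))
      exact h3

end Bargmann

/-! ### Coherent states and the reproducing property -/

namespace Bargmann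

variable {n : ℕ}

lemma FormBound.mono {M : Matrix (Fin n) (Fin n) ℂ} {r r' : ℝ} (h : FormBound M r) (hr : r ≤ r') :
    FormBound M r' := fun z => (h z).trans (by gcongr)

lemma formBound_zero : FormBound (0 : Matrix (Fin n) (Fin n) ℂ) 0 := fun z => by simp

lemma quadForm_zero (b z : Fin n → ℂ) : quadForm 0 b z = b ⬝ᵥ z := by simp [quadForm]

/-- The coherent state `exp (ᵗw ū)`. -/
noncomputable def expVec (w : Fin n → ℂ) : space n := gaussVec formBound_zero zero_lt_one w

lemma conj_exp_dotProduct (w z : Fin n → ℂ) :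
    conj (Complex.exp (w ⬝ᵥ star z)) = Complex.exp (star w ⬝ᵥ z) := by
  rw [← Complex.exp_conj]
  simp [dotProduct]

lemma coeFn_expVec (w : Fin n → ℂ) : (expVec w : Lp ℂ 2 (gaussian n)) =ᵐ[gaussian n]
    fun u => Complex.exp (w ⬝ᵥ star u) := by
  have := coeFn_ofEntire (differentiable_quadForm 0 w).cexp
    (memLp_gaussian formBound_zero zero_lt_one w)
  exact this.trans (Filter.Eventually.of_forall fun u => by simp only [quadForm_zero])

lemma inner_expVec_eq_integral (w : Fin n → ℂ) (f : space n) {g : (Fin n → ℂ) → ℂ}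
    (hg : (f : Lp ℂ 2 (gaussian n)) =ᵐ[gaussian n] g) :
    Integrable (fun v => Complex.exp (star w ⬝ᵥ v) * g v) (gaussian n) ∧
    ⟪expVec w, f⟫_ℂ = ∫ v, Complex.exp (star w ⬝ᵥ v) * g v ∂(gaussian n) := by
  have hae : (fun v => ⟪((expVec w : Lp ℂ 2 (gaussian n)) : (Fin n → ℂ) → ℂ) v,
      (f : Lp ℂ 2 (gaussian n)) v⟫_ℂ) =ᵐ[gaussian n]
      fun v => Complex.exp (star w ⬝ᵥ v) * g v := by
    filter_upwards [coeFn_expVec w, hg] with v h1 h2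
    rw [h1, h2, RCLike.inner_apply, conj_exp_dotProduct, mul_comm]
  exact ⟨(L2.integrable_inner (𝕜 := ℂ) (expVec w : Lp ℂ 2 (gaussian n)) f).congr hae,
    (L2.inner_def (𝕜 := ℂ) (expVec w : Lp ℂ 2 (gaussian n)) f).trans (integral_congr_ae hae)⟩

lemma inner_expVec_ofEntire (w : Fin n → ℂ) {F : (Fin n → ℂ) → ℂ} (hF : Differentiable ℂ F)
    (hL : MemLp (fun u => F (star u)) 2 (gaussian n)) :
    ⟪expVec w, ofEntire F hF hL⟫_ℂ = F (star w) := by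
  obtain ⟨h1, h2⟩ := inner_expVec_eq_integral w (ofEntire F hF hL) (coeFn_ofEntire hF hL)
  rw [h2, integral_exp_mul_entire hF w h1]

/-- The reproducing property passes to the closure of the antiholomorphic functions, since a
subsequence of an `L²`-convergent sequence converges almost everywhere. -/
lemma coeFn_ae_eq_inner_expVec (f : space n) :
    (f : Lp ℂ 2 (gaussian n)) =ᵐ[gaussian n] fun u => ⟪expVec u, f⟫_ℂ := by
  obtain ⟨g, hg, hlim⟩ := mem_closure_iff_seq_limit.1 f.2
  choose F hF hgF using hg
  let h : ℕ → space n := fun k => ⟨g k, Submodule.le_topologicalClosure _ ⟨F k, hF k, hgF k⟩⟩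
  have hh : Filter.Tendsto h Filter.atTop (nhds f) := tendsto_subtype_rng.2 hlim
  obtain ⟨ns, hns, hae⟩ := (tendstoInMeasure_of_tendsto_Lp hlim).exists_seq_tendsto_ae
  have hrep : ∀ k u, ⟪expVec u, h k⟫_ℂ = F k (star u) := fun k u => by
    obtain ⟨h1, h2⟩ := inner_expVec_eq_integral u (h k) (hgF k)
    rw [h2, integral_exp_mul_entire (hF k) u h1]
  filter_upwards [hae, ae_all_iff.2 hgF] with u h1 h2
  have h3 : Filter.Tendsto (fun i => ⟪expVec u, h (ns i)⟫_ℂ) Filter.atTop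
      (nhds ⟪expVec u, f⟫_ℂ) :=
    tendsto_const_nhds.inner (hh.comp hns.tendsto_atTop)
  refine tendsto_nhds_unique h1 (h3.congr fun i => ?_)
  rw [hrep, h2]

/-- The coherent states are total. -/
lemma eq_zero_of_inner_expVec {f : space n} (h : ∀ w, ⟪expVec w, f⟫_ℂ = 0) : f = 0 := by
  apply Subtype.ext
  rw [Lp.ext_iff]
  filter_upwards [coeFn_ae_eq_inner_expVec f, Lp.coeFn_zero ℂ 2 (gaussian n)] with u h1 h2
  rw [h1, h]
  exact h2.symm

lemma dense_hamiltonian_domain (B C : Matrix (Fin n) (Fin n) ℂ) :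
    Dense ((hamiltonian B C).domain : Set (space n)) := by
  rw [Submodule.dense_iff_topologicalClosure_eq_top, Submodule.topologicalClosure_eq_top_iff,
    Submodule.eq_bot_iff]
  intro f hf
  refine eq_zero_of_inner_expVec fun w => ?_
  have hw : expVec w ∈ closure ((hamiltonian B C).domain : Set (space n)) := by
    refine map_mem_closure (f := Prod.fst) continuous_fst
      (gaussVec_mem_closure B C Matrix.isSymm_zero formBound_zero zero_lt_one w) ?_
    rintro ⟨x, y⟩ hxy
    exact LinearPMap.mem_domain_of_mem_graph hxy
  rw [← Submodule.orthogonal_closure, Submodule.mem_orthogonal] at hf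
  exact hf _ hw

lemma gaussVec_mem_graph {B C : Matrix (Fin n) (Fin n) ℂ}
    (hH : (hamiltonian B C).IsFormalAdjoint (hamiltonian B C)) {M : Matrix (Fin n) (Fin n) ℂ}
    (hsymm : M.IsSymm) {r : ℝ} (hM : FormBound M r) (hr : r < 1) (b : Fin n → ℂ) :
    (gaussVec hM hr b, gaussImage hM hr B C b) ∈ (hamiltonian B C).closure.graph := by
  rw [← (isClosable_of_symmetric (dense_hamiltonian_domain B C)
    hH).graph_closure_eq_closure_graph]
  exact gaussVec_mem_closure B C hsymm hM hr b

lemma inner_expVec_gaussVec {M : Matrix (Fin n) (Fin n) ℂ} {r : ℝ} (hM : FormBound M r)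
    (hr : r < 1) (b w : Fin n → ℂ) :
    ⟪expVec w, gaussVec hM hr b⟫_ℂ = Complex.exp (quadForm M b (star w)) :=
  inner_expVec_ofEntire w _ _

lemma inner_expVec_gaussImage {M : Matrix (Fin n) (Fin n) ℂ} {r : ℝ} (hM : FormBound M r)
    (hr : r < 1) (B C : Matrix (Fin n) (Fin n) ℂ) (b w : Fin n → ℂ) :
    ⟪expVec w, gaussImage hM hr B C b⟫_ℂ = symbol B C M b (star w)
      (Complex.exp (quadForm M b (star w))) (Complex.exp (quadForm M b (star w)))
      (Complex.exp (quadForm M b (star w))) :=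
  inner_expVec_ofEntire w _ _

lemma symbol_zero (B C : Matrix (Fin n) (Fin n) ℂ) (b z : Fin n → ℂ) (e : ℂ) :
    symbol B C 0 b z e e e = (1 / 2 * ∑ j, ∑ k, B j k * (z j * z k) +
      1 / 2 * ∑ j, ∑ k, conj (B j k) * (b j * b k) + ∑ j, ∑ k, C j k * (z j * b k)) * e := by
  simp only [symbol, Matrix.zero_mulVec, zero_add, Matrix.zero_apply, Finset.mul_sum,
    Finset.sum_mul, ← Finset.sum_add_distrib, add_mul]
  refine Finset.sum_congr rfl fun j _ => Finset.sum_congr rfl fun k _ => ?_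
  ring

/-- Formal self-adjointness of the Hamiltonian, tested on coherent states, makes `C` hermitian. -/
lemma isHermitian_of_isFormalAdjoint {B C : Matrix (Fin n) (Fin n) ℂ}
    (hH : (hamiltonian B C).IsFormalAdjoint (hamiltonian B C)) : C.IsHermitian := by
  have hd := dense_hamiltonian_domain B C
  have key : ∀ v w : Fin n → ℂ,
      conj ⟪expVec v, gaussImage formBound_zero zero_lt_one B C w⟫_ℂ =
        ⟪expVec w, gaussImage formBound_zero zero_lt_one B C v⟫_ℂ := fun v w => by
    refine (inner_conj_symm (𝕜 := ℂ) (gaussImage formBound_zero zero_lt_one B C w)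
      (expVec v)).trans ?_
    exact inner_closure_graph hd hH (gaussVec_mem_graph hH Matrix.isSymm_zero _ _ _)
      (closure_graph_le_adjoint hd hH (gaussVec_mem_graph hH Matrix.isSymm_zero _ _ _))
  ext j k
  -- On the coherent states of two unit vectors the `B`-terms of both sides agree.
  have h := key (Pi.single k 1) (Pi.single j 1)
  simp only [inner_expVec_gaussImage, symbol_zero, quadForm_zero, map_mul,
    conj_exp_dotProduct] at h
  have hdot : star (Pi.single j (1 : ℂ)) ⬝ᵥ Pi.single k 1 =
      Pi.single (M := fun _ : Fin n => ℂ) k 1 ⬝ᵥ star (Pi.single j (1 : ℂ)) := dotProduct_comm _ _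
  rw [hdot] at h
  have h' := mul_right_cancel₀ (Complex.exp_ne_zero _) h
  have hs : ∀ (l : Fin n), star (Pi.single l (1 : ℂ)) = Pi.single (M := fun _ : Fin n => ℂ) l 1 :=
    fun l => by
      ext i
      by_cases hi : i = l <;> simp [hi]
  simp only [hs, Pi.single_apply, mul_ite, mul_one, mul_zero, Finset.sum_ite_eq', Finset.mem_univ,
    if_true, map_add, map_mul, Complex.conj_conj] at h'
  rw [Matrix.conjTranspose_apply]
  have hconj : conj (2 : ℂ) = 2 := map_ofNat _ 2
  simp only [one_div, map_inv₀, hconj] at h'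
  have : star (C k j) = conj (C k j) := rfl
  rw [this]
  linear_combination h'

/-! ### Continuous families of Gaussian vectors -/

section Family

variable {M : ℝ → Matrix (Fin n) (Fin n) ℂ} {b : ℝ → Fin n → ℂ} {r : ℝ → ℝ}

lemma continuous_coeffSize (hMc : Continuous M) (hbc : Continuous b) :
    Continuous fun t => coeffSize (M t) (b t) := by
  unfold coeffSize
  fun_prop

lemma continuous_quadForm (hMc : Continuous M) (hbc : Continuous b) (z : Fin n → ℂ) :
    Continuous fun t => quadForm (M t) (b t) z := by
  unfold quadForm
  simp only [dotProduct, Matrix.mulVec]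
  fun_prop

lemma continuous_gaussImage (B C : Matrix (Fin n) (Fin n) ℂ) (hMc : Continuous M)
    (hbc : Continuous b) (hrc : Continuous r) (hM : ∀ t, FormBound (M t) (r t))
    (hr : ∀ t, r t < 1) : Continuous fun t => gaussImage (hM t) (hr t) B C (b t) := by
  rw [continuous_iff_continuousAt]
  intro t₀
  obtain ⟨r₀, hr₀, hr₁⟩ := exists_between (hr t₀)
  obtain ⟨K, r', hr', h⟩ := exists_gaussian_majorant B C (coeffSize (M t₀) (b t₀) + 1) hr₁
  refine tendsto_ofEntire (F := fun t z => symbol B C (M t) (b t) z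
      (Complex.exp (quadForm (M t) (b t) z)) (Complex.exp (quadForm (M t) (b t) z))
      (Complex.exp (quadForm (M t) (b t) z)))
    (F₀ := fun z => symbol B C (M t₀) (b t₀) z
      (Complex.exp (quadForm (M t₀) (b t₀) z)) (Complex.exp (quadForm (M t₀) (b t₀) z))
      (Complex.exp (quadForm (M t₀) (b t₀) z))) (K := K) _ _ _ _ hr' ?_ ?_ ?_
  · have h1 := (continuous_coeffSize hMc hbc).tendsto t₀ |>.eventually_le_const
      (lt_add_one (coeffSize (M t₀) (b t₀)))
    filter_upwards [h1, (hrc.tendsto t₀).eventually_le_const hr₀] with t h1 h2 z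
    exact (h (M t) (b t) ((hM t).mono h2) h1 z).2 _ _ _ (Complex.norm_exp_le_exp_norm _) (Complex.norm_exp_le_exp_norm _)
      (Complex.norm_exp_le_exp_norm _)
  · intro z
    exact (h (M t₀) (b t₀) ((hM t₀).mono hr₀.le) (by linarith) z).2 _ _ _ (Complex.norm_exp_le_exp_norm _)
      (Complex.norm_exp_le_exp_norm _) (Complex.norm_exp_le_exp_norm _)
  · intro z
    have hq := (continuous_quadForm hMc hbc z).cexp
    have hc : Continuous fun t => symbol B C (M t) (b t) z
        (Complex.exp (quadForm (M t) (b t) z)) (Complex.exp (quadForm (M t) (b t) z))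
        (Complex.exp (quadForm (M t) (b t) z)) := by
      unfold symbol
      simp only [Pi.add_apply, Matrix.mulVec, dotProduct]
      fun_prop
    exact hc.tendsto t₀

end Family

end Bargmann

/-! ### The Bogoliubov matrices -/

namespace Bargmann

open scoped Matrix ComplexOrder

variable {n : ℕ}

section Algebra

variable {B C : Matrix (Fin n) (Fin n) ℂ}

lemma map_conj_eq {m : Type*} (M : Matrix m m ℂ) : M.map conj = Mᴴᵀ := rfl

lemma conjTranspose_map_conj {m : Type*} (M : Matrix m m ℂ) : (M.map conj)ᴴ = Mᵀ := by
  ext i j; simp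

lemma transpose_map_conj {m : Type*} (M : Matrix m m ℂ) : (M.map conj)ᵀ = Mᴴ := rfl

/-- The indefinite metric `diag (1, -1)` preserved by the Bogoliubov matrices. -/
def signMatrix (n : ℕ) : Matrix (Fin n ⊕ Fin n) (Fin n ⊕ Fin n) ℂ := Matrix.fromBlocks 1 0 0 (-1)

/-- The exchange of the two copies of `ℂⁿ`. -/
def swapMatrix (n : ℕ) : Matrix (Fin n ⊕ Fin n) (Fin n ⊕ Fin n) ℂ := Matrix.fromBlocks 0 1 1 0

lemma signMatrix_mul_self : signMatrix n * signMatrix n = 1 := by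
  simp [signMatrix, Matrix.fromBlocks_multiply]

lemma swapMatrix_mul_self : swapMatrix n * swapMatrix n = 1 := by
  simp [swapMatrix, Matrix.fromBlocks_multiply]

/-- The exponential commutes with conjugation by an involution. -/
lemma exp_conj_involution {m : Type*} [Fintype m] [DecidableEq m] {J : Matrix m m ℂ}
    (hJ : J * J = 1) (A : Matrix m m ℂ) :
    NormedSpace.exp (J * A * J) = J * NormedSpace.exp A * J := by
  have h := Matrix.exp_conj J A ⟨⟨J, J, hJ, hJ⟩, rfl⟩
  rwa [Matrix.inv_eq_left_inv hJ] at h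

lemma conjTranspose_generatorMatrix (hB : B.IsSymm) (hC : C.IsHermitian) :
    (generatorMatrix B C)ᴴ = signMatrix n * generatorMatrix B C * signMatrix n := by
  have h1 : Bᴴ = B.map conj := by ext i j; simp [hB.apply i j]
  have h2 : Cᵀ = C.map conj := by rw [map_conj_eq, hC.eq]
  simp [generatorMatrix, signMatrix, Matrix.fromBlocks_multiply, Matrix.fromBlocks_conjTranspose,
    conjTranspose_map_conj, h1, h2, hC.eq, hB.eq]

lemma map_conj_generatorMatrix :
    (generatorMatrix B C).map conj = -(swapMatrix n * generatorMatrix B C * swapMatrix n) := by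
  ext i j
  rcases i with i | i <;> rcases j with j | j <;>
    simp [generatorMatrix, swapMatrix, Matrix.fromBlocks_multiply, Matrix.map]

lemma bogoliubov_zero : bogoliubov B C 0 = 1 := by simp [bogoliubov]

lemma bogoliubov_mul_neg (t : ℝ) : bogoliubov B C t * bogoliubov B C (-t) = 1 := by
  rw [bogoliubov, bogoliubov, ← Matrix.exp_add_of_commute]
  · rw [← add_smul]; simp
  · exact ((Commute.refl _).smul_left _).smul_right _

lemma conjTranspose_bogoliubov (hB : B.IsSymm) (hC : C.IsHermitian) (t : ℝ) :
    (bogoliubov B C t)ᴴ = signMatrix n * bogoliubov B C (-t) * signMatrix n := by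
  rw [bogoliubov, ← Matrix.exp_conjTranspose, Matrix.conjTranspose_smul,
    conjTranspose_generatorMatrix hB hC, bogoliubov, ← exp_conj_involution signMatrix_mul_self]
  congr 1
  simp

lemma map_conj_bogoliubov (t : ℝ) :
    (bogoliubov B C t).map conj = swapMatrix n * bogoliubov B C t * swapMatrix n := by
  rw [map_conj_eq, bogoliubov, ← Matrix.exp_conjTranspose, ← Matrix.exp_transpose,
    Matrix.conjTranspose_smul, Matrix.transpose_smul, ← map_conj_eq, map_conj_generatorMatrix,
    ← exp_conj_involution swapMatrix_mul_self]
  congr 1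
  simp

lemma bogoliubov_eq_fromBlocks (t : ℝ) :
    bogoliubov B C t = Matrix.fromBlocks (Phi B C t) (Psi B C t)
      ((Psi B C t).map conj) ((Phi B C t).map conj) := by
  have h := map_conj_bogoliubov (B := B) (C := C) t
  rw [← Matrix.fromBlocks_toBlocks (bogoliubov B C t)] at h ⊢
  rw [Matrix.fromBlocks_map] at h
  simp only [swapMatrix, Matrix.fromBlocks_multiply, zero_mul, one_mul, zero_add, mul_zero, mul_one,
    add_zero, Matrix.fromBlocks_inj] at h
  rw [Matrix.fromBlocks_inj]
  exact ⟨rfl, rfl, h.2.1.symm, h.1.symm⟩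

/-- The blocks of a Bogoliubov matrix satisfy the relations that make it preserve the metric
`diag (1, -1)`. -/
lemma block_relations (hB : B.IsSymm) (hC : C.IsHermitian) (t : ℝ) :
    Phi B C t * (Phi B C t)ᴴ - Psi B C t * (Psi B C t)ᴴ = 1 ∧
    Phi B C t * (Psi B C t)ᵀ = Psi B C t * (Phi B C t)ᵀ ∧
    (Phi B C t)ᴴ * Psi B C t = (Psi B C t)ᵀ * (Phi B C t).map conj := by
  have h1 : bogoliubov B C t * (signMatrix n * (bogoliubov B C t)ᴴ * signMatrix n) = 1 := by
    rw [conjTranspose_bogoliubov hB hC, mul_assoc (signMatrix n), mul_assoc _ (signMatrix n),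
      signMatrix_mul_self, mul_one, ← mul_assoc (signMatrix n), signMatrix_mul_self, one_mul,
      bogoliubov_mul_neg]
  have h2 := mul_eq_one_comm.1 h1
  rw [bogoliubov_eq_fromBlocks] at h1 h2
  simp only [signMatrix, Matrix.fromBlocks_multiply, Matrix.fromBlocks_conjTranspose, zero_mul,
    one_mul, zero_add, mul_zero, mul_one, add_zero, neg_mul, mul_neg, neg_neg,
    conjTranspose_map_conj, ← Matrix.fromBlocks_one, Matrix.fromBlocks_inj] at h1 h2
  refine ⟨?_, ?_, ?_⟩
  · rw [sub_eq_add_neg]; exact h1.1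
  · rw [← sub_eq_zero, ← neg_eq_zero, neg_sub, sub_eq_add_neg, add_comm]; exact h1.2.1
  · rw [← sub_eq_zero, sub_eq_add_neg]; exact h2.2.1

lemma isUnit_det_Phi (hB : B.IsSymm) (hC : C.IsHermitian) (t : ℝ) : IsUnit (Phi B C t).det := by
  have h := (block_relations hB hC t).1
  rw [sub_eq_iff_eq_add] at h
  -- `Φ Φᴴ = 1 + Ψ Ψᴴ` is positive definite.
  have hpd : (Phi B C t * (Phi B C t)ᴴ).PosDef := by
    rw [h]
    exact Matrix.PosDef.one.add_posSemidef (Matrix.posSemidef_self_mul_conjTranspose _)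
  have hu := (Matrix.isUnit_iff_isUnit_det _).1 hpd.isUnit
  rw [Matrix.det_mul] at hu
  exact isUnit_of_mul_isUnit_left hu

/-- The block `A²² = -Φ⁻¹Ψ` of the kernel matrix. -/
noncomputable def outerBlock (B C : Matrix (Fin n) (Fin n) ℂ) (t : ℝ) : Matrix (Fin n) (Fin n) ℂ :=
  -((Phi B C t)⁻¹ * Psi B C t)

/-- The block `A¹¹ = Ψ̄Φ⁻¹` of the kernel matrix. -/
noncomputable def innerBlock (B C : Matrix (Fin n) (Fin n) ℂ) (t : ℝ) : Matrix (Fin n) (Fin n) ℂ :=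
  (Psi B C t).map conj * (Phi B C t)⁻¹

lemma isSymm_outerBlock (hB : B.IsSymm) (hC : C.IsHermitian) (t : ℝ) :
    (outerBlock B C t).IsSymm := by
  have hu := isUnit_det_Phi hB hC t
  have h := (block_relations hB hC t).2.1
  have hu' : IsUnit (Phi B C t)ᵀ.det := by rwa [Matrix.det_transpose]
  rw [Matrix.IsSymm, outerBlock, Matrix.transpose_neg, Matrix.transpose_mul,
    Matrix.transpose_nonsing_inv, neg_inj]
  calc (Psi B C t)ᵀ * ((Phi B C t)ᵀ)⁻¹
      = (Phi B C t)⁻¹ * (Phi B C t * (Psi B C t)ᵀ) * ((Phi B C t)ᵀ)⁻¹ := by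
        rw [Matrix.nonsing_inv_mul_cancel_left _ _ hu]
    _ = (Phi B C t)⁻¹ * Psi B C t := by
        rw [h, ← mul_assoc, Matrix.mul_nonsing_inv_cancel_right _ _ hu']

lemma isSymm_innerBlock (hB : B.IsSymm) (hC : C.IsHermitian) (t : ℝ) :
    (innerBlock B C t).IsSymm := by
  have hu := isUnit_det_Phi hB hC t
  have h := congrArg (fun M => M.map conj) (block_relations hB hC t).2.2
  have hu' : IsUnit (Phi B C t)ᵀ.det := by rwa [Matrix.det_transpose]
  have h' : (Phi B C t)ᵀ * (Psi B C t).map conj = (Psi B C t)ᴴ * Phi B C t := by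
    simp only [Matrix.map_mul] at h
    convert! h using 2
    · ext i j; simp
    · ext i j; simp
  rw [Matrix.IsSymm, innerBlock, Matrix.transpose_mul, Matrix.transpose_nonsing_inv,
    transpose_map_conj]
  calc ((Phi B C t)ᵀ)⁻¹ * (Psi B C t)ᴴ
      = ((Phi B C t)ᵀ)⁻¹ * ((Psi B C t)ᴴ * Phi B C t * (Phi B C t)⁻¹) := by
        rw [Matrix.mul_nonsing_inv_cancel_right _ _ hu]
    _ = (Psi B C t).map conj * (Phi B C t)⁻¹ := by
        rw [← h', mul_assoc, Matrix.nonsing_inv_mul_cancel_left _ _ hu']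

lemma isSymm_kernelMatrix (hB : B.IsSymm) (hC : C.IsHermitian) (t : ℝ) :
    (kernelMatrix B C t).IsSymm := by
  have h1 := isSymm_outerBlock hB hC t
  have h2 := isSymm_innerBlock hB hC t
  simp only [Matrix.IsSymm, outerBlock, innerBlock] at h1 h2
  rw [Matrix.IsSymm, kernelMatrix, Matrix.fromBlocks_transpose, h1, h2, Matrix.transpose_transpose]

/-- `Φ̄ - Ψ̄Φ⁻¹Ψ = ᵗΦ⁻¹`. -/
lemma schur_complement (hB : B.IsSymm) (hC : C.IsHermitian) (t : ℝ) :
    (Phi B C t).map conj - (Psi B C t).map conj * (Phi B C t)⁻¹ * Psi B C t =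
      ((Phi B C t)⁻¹)ᵀ := by
  have hu := isUnit_det_Phi hB hC t
  have hs := isSymm_outerBlock hB hC t
  simp only [Matrix.IsSymm, outerBlock, Matrix.transpose_neg, neg_inj] at hs
  rw [← Matrix.transpose_inj, Matrix.transpose_transpose, Matrix.transpose_sub, mul_assoc,
    Matrix.transpose_mul, hs, transpose_map_conj, transpose_map_conj]
  calc (Phi B C t)ᴴ - (Phi B C t)⁻¹ * Psi B C t * (Psi B C t)ᴴ
      = (Phi B C t)⁻¹ * (Phi B C t * (Phi B C t)ᴴ - Psi B C t * (Psi B C t)ᴴ) := by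
        rw [mul_sub, Matrix.nonsing_inv_mul_cancel_left _ _ hu, mul_assoc]
    _ = _ := by rw [(block_relations hB hC t).1, mul_one]

/-- With `S = A²²`: `S Sᴴ + Φ⁻¹ Φ⁻¹ᴴ = 1`, so that `S` is a strict contraction. -/
lemma outerBlock_contraction (hB : B.IsSymm) (hC : C.IsHermitian) (t : ℝ) :
    outerBlock B C t * (outerBlock B C t)ᴴ + ((Phi B C t)⁻¹ * ((Phi B C t)⁻¹)ᴴ) = 1 := by
  have hu := isUnit_det_Phi hB hC t
  have hu' : IsUnit (Phi B C t)ᴴ.det := by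
    rw [Matrix.det_conjTranspose]; exact hu.star
  have h := (block_relations hB hC t).1
  rw [sub_eq_iff_eq_add] at h
  rw [outerBlock, Matrix.conjTranspose_neg, Matrix.conjTranspose_mul, neg_mul_neg,
    Matrix.conjTranspose_nonsing_inv]
  calc _ = (Phi B C t)⁻¹ * (1 + Psi B C t * (Psi B C t)ᴴ) * ((Phi B C t)ᴴ)⁻¹ := by
        noncomm_ring
    _ = 1 := by
        rw [← h, Matrix.nonsing_inv_mul_cancel_left _ _ hu, Matrix.mul_nonsing_inv _ hu']

end Algebra

section Bound

lemma star_dotProduct_self (x : Fin n → ℂ) : star x ⬝ᵥ x = ((radius x ^ 2 : ℝ) : ℂ) := by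
  rw [sq_radius]
  simp [dotProduct, Complex.conj_mul']

lemma radius_star (x : Fin n → ℂ) : radius (star x) = radius x := by simp [radius]

lemma norm_dotProduct_le (x y : Fin n → ℂ) : ‖x ⬝ᵥ y‖ ≤ radius x * radius y := by
  refine (norm_sum_le _ _).trans ?_
  simp only [norm_mul]
  exact Real.sum_mul_le_sqrt_mul_sqrt _ _ _

lemma sq_radius_mulVec_le (V : Matrix (Fin n) (Fin n) ℂ) (x : Fin n → ℂ) :
    radius (V *ᵥ x) ^ 2 ≤ (∑ i, ∑ j, ‖V i j‖ ^ 2) * radius x ^ 2 := by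
  rw [sq_radius (V *ᵥ x), Finset.sum_mul]
  refine Finset.sum_le_sum fun i _ => ?_
  have h := norm_dotProduct_le (V i) x
  calc ‖(V *ᵥ x) i‖ ^ 2 ≤ (radius (V i) * radius x) ^ 2 := by gcongr; exact h
    _ = _ := by rw [mul_pow, sq_radius (V i)]

/-- If `S Sᴴ + Wᴴ W = 1` and `W` is bounded below, then the quadratic form of `S` is bounded by a
constant less than one. -/
lemma formBound_of_contraction {S W V : Matrix (Fin n) (Fin n) ℂ}
    (hS : S * Sᴴ + Wᴴ * W = 1) (hV : V * W = 1) (hsymm : S.IsSymm) :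
    FormBound S √(1 - 1 / (1 + ∑ i, ∑ j, ‖V i j‖ ^ 2)) := by
  intro z
  set f := 1 + ∑ i, ∑ j, ‖V i j‖ ^ 2 with hf
  have hf0 : 0 < f := by positivity
  have hf1 : 1 ≤ f := by rw [hf]; simp; positivity
  set x := star z with hx
  have hsq : radius (Sᴴ *ᵥ x) ^ 2 + radius (W *ᵥ x) ^ 2 = radius x ^ 2 := by
    have h := congrArg (fun M => star x ⬝ᵥ (M *ᵥ x)) hS
    simp only [Matrix.add_mulVec, dotProduct_add, Matrix.one_mulVec, ← Matrix.mulVec_mulVec,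
      Matrix.dotProduct_mulVec (star x)] at h
    rw [← Matrix.conjTranspose_conjTranspose S, Matrix.conjTranspose_conjTranspose (Sᴴ),
      ← Matrix.star_mulVec, ← Matrix.star_mulVec, star_dotProduct_self, star_dotProduct_self,
      star_dotProduct_self] at h
    exact_mod_cast h
  have hW : radius x ^ 2 ≤ f * radius (W *ᵥ x) ^ 2 := by
    have h := sq_radius_mulVec_le V (W *ᵥ x)
    rw [Matrix.mulVec_mulVec, hV, Matrix.one_mulVec] at h
    have : 0 ≤ radius (W *ᵥ x) ^ 2 := by positivity
    rw [hf]
    linarith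
  have hle : radius (Sᴴ *ᵥ x) ^ 2 ≤ (1 - 1 / f) * radius x ^ 2 := by
    have : 1 / f * radius x ^ 2 ≤ radius (W *ᵥ x) ^ 2 := by
      rw [one_div, inv_mul_le_iff₀ hf0]; exact hW
    linarith
  have hr : 0 ≤ 1 - 1 / f := by
    rw [sub_nonneg, div_le_one hf0]; exact hf1
  have hle' : radius (Sᴴ *ᵥ x) ≤ √(1 - 1 / f) * radius x := by
    refine abs_le_of_sq_le_sq' ?_ (mul_nonneg (Real.sqrt_nonneg _) (radius_nonneg _)) |>.2
    rw [mul_pow, Real.sq_sqrt hr]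
    exact hle
  have hSz : star (Sᴴ *ᵥ x) = S *ᵥ z := by
    rw [Matrix.star_mulVec, Matrix.conjTranspose_conjTranspose, hx, star_star,
      ← Matrix.mulVec_transpose, hsymm.eq]
  rw [← sq_radius]
  calc ‖z ⬝ᵥ S *ᵥ z‖ ≤ radius z * radius (S *ᵥ z) := norm_dotProduct_le _ _
    _ = radius z * radius (Sᴴ *ᵥ x) := by rw [← hSz, radius_star]
    _ ≤ radius z * (√(1 - 1 / f) * radius x) := by gcongr; exact radius_nonneg z
    _ = _ := by rw [hx, radius_star]; ring

/-- A bound, continuous in `t`, for the quadratic form of `outerBlock`. -/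
noncomputable def outerBound (B C : Matrix (Fin n) (Fin n) ℂ) (t : ℝ) : ℝ :=
  √(1 - 1 / (1 + ∑ i, ∑ j, ‖(Phi B C t)ᴴ i j‖ ^ 2))

lemma outerBound_lt_one (B C : Matrix (Fin n) (Fin n) ℂ) (t : ℝ) : outerBound B C t < 1 := by
  rw [outerBound, Real.sqrt_lt' one_pos]
  have : 0 < 1 / (1 + ∑ i, ∑ j, ‖(Phi B C t)ᴴ i j‖ ^ 2) := by positivity
  linarith

lemma formBound_outerBlock {B C : Matrix (Fin n) (Fin n) ℂ} (hB : B.IsSymm) (hC : C.IsHermitian)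
    (t : ℝ) : FormBound (outerBlock B C t) (outerBound B C t) := by
  refine formBound_of_contraction (W := ((Phi B C t)⁻¹)ᴴ) ?_ ?_ (isSymm_outerBlock hB hC t)
  · rw [Matrix.conjTranspose_conjTranspose]; exact outerBlock_contraction hB hC t
  · rw [← Matrix.conjTranspose_mul, Matrix.nonsing_inv_mul _ (isUnit_det_Phi hB hC t),
      Matrix.conjTranspose_one]

end Bound

end Bargmann

/-! ### Differential equations for the blocks and the normalization -/

namespace Bargmann

open scoped Matrix

variable {n : ℕ}

section Derivatives

attribute [local instance] Matrix.linftyOpNormedRing Matrix.linftyOpNormedAlgebra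

variable {B C : Matrix (Fin n) (Fin n) ℂ}

/-- Jacobi's formula for the derivative of a determinant. -/
lemma hasDerivAt_det {W : ℝ → Matrix (Fin n) (Fin n) ℂ} {W' : Matrix (Fin n) (Fin n) ℂ} {t : ℝ}
    (h : ∀ i j, HasDerivAt (fun t => W t i j) (W' i j) t) :
    HasDerivAt (fun t => (W t).det) ((W t).adjugate * W').trace t := by
  have h1 : HasDerivAt (fun t => (W t).det) (∑ σ : Equiv.Perm (Fin n), Equiv.Perm.sign σ •
      ∑ i, (∏ j ∈ Finset.univ.erase i, W t (σ j) j) • W' (σ i) i) t := by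
    simp only [Matrix.det_apply]
    exact HasDerivAt.fun_sum fun σ _ => (HasDerivAt.fun_finsetProd fun i _ => h (σ i) i).const_smul _
  convert! h1 using 1
  have h2 : ((W t).adjugate * W').trace = ∑ i, ((W t).updateCol i fun k => W' k i).det := by
    simp only [Matrix.trace, Matrix.diag, ← Matrix.cramer_apply, Matrix.cramer_eq_adjugate_mulVec]
    rfl
  rw [h2]
  simp only [Matrix.det_apply, Finset.smul_sum]
  rw [Finset.sum_comm]
  refine Finset.sum_congr rfl fun σ _ => Finset.sum_congr rfl fun i _ => ?_
  rw [← Finset.mul_prod_erase _ _ (Finset.mem_univ i), Matrix.updateCol_self, smul_eq_mul, mul_comm]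
  congr 2
  refine Finset.prod_congr rfl fun j hj => ?_
  rw [Matrix.updateCol_ne (Finset.ne_of_mem_erase hj)]

lemma hasDerivAt_exp_I_smul {m : Type*} [Fintype m] [DecidableEq m] (A : Matrix m m ℂ) (t : ℝ) :
    HasDerivAt (fun t : ℝ => NormedSpace.exp ((Complex.I * (t : ℂ)) • A))
      (Complex.I • (NormedSpace.exp ((Complex.I * (t : ℂ)) • A) * A)) t := by
  have h1 : HasDerivAt (fun s : ℝ => Complex.I * (s : ℂ)) Complex.I t := by
    simpa using (Complex.ofRealCLM.hasDerivAt (x := t)).const_mul Complex.I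
  exact (hasDerivAt_exp_smul_const (𝕂 := ℂ) A (Complex.I * (t : ℂ))).scomp t h1

/-- A block of a differentiable matrix function, or any other linear function of it, is
differentiable. -/
lemma hasDerivAt_linear_comp {E F : Type*} [NormedAddCommGroup E] [NormedSpace ℂ E]
    [FiniteDimensional ℂ E] [NormedAddCommGroup F] [NormedSpace ℂ F] (L : E →ₗ[ℂ] F) {f : ℝ → E}
    {f' : E} {t : ℝ} (h : HasDerivAt f f' t) : HasDerivAt (fun t => L (f t)) (L f') t :=
  ((LinearMap.toContinuousLinearMap L).restrictScalars ℝ).hasFDerivAt.comp_hasDerivAt t h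

lemma hasDerivAt_blocks (t : ℝ) :
    HasDerivAt (Phi B C) (Complex.I • (Psi B C t * B.map conj - Phi B C t * C)) t ∧
    HasDerivAt (Psi B C) (Complex.I • (Psi B C t * C.map conj - Phi B C t * B)) t ∧
    HasDerivAt (fun t => (Psi B C t).map conj)
      (Complex.I • ((Phi B C t).map conj * B.map conj - (Psi B C t).map conj * C)) t := by
  have h : HasDerivAt (bogoliubov B C)
      (Complex.I • (bogoliubov B C t * generatorMatrix B C)) t := hasDerivAt_exp_I_smul _ t
  have hE : bogoliubov B C t * generatorMatrix B C = Matrix.fromBlocks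
      (Psi B C t * B.map conj - Phi B C t * C) (Psi B C t * C.map conj - Phi B C t * B)
      ((Phi B C t).map conj * B.map conj - (Psi B C t).map conj * C)
      ((Phi B C t).map conj * C.map conj - (Psi B C t).map conj * B) := by
    rw [bogoliubov_eq_fromBlocks, generatorMatrix, Matrix.fromBlocks_multiply]
    simp only [mul_neg, neg_add_eq_sub]
  rw [hE] at h
  let L₁₁ : Matrix (Fin n ⊕ Fin n) (Fin n ⊕ Fin n) ℂ →ₗ[ℂ] Matrix (Fin n) (Fin n) ℂ :=
    { toFun := Matrix.toBlocks₁₁, map_add' := fun _ _ => rfl, map_smul' := fun _ _ => rfl }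
  let L₁₂ : Matrix (Fin n ⊕ Fin n) (Fin n ⊕ Fin n) ℂ →ₗ[ℂ] Matrix (Fin n) (Fin n) ℂ :=
    { toFun := Matrix.toBlocks₁₂, map_add' := fun _ _ => rfl, map_smul' := fun _ _ => rfl }
  let L₂₁ : Matrix (Fin n ⊕ Fin n) (Fin n ⊕ Fin n) ℂ →ₗ[ℂ] Matrix (Fin n) (Fin n) ℂ :=
    { toFun := Matrix.toBlocks₂₁, map_add' := fun _ _ => rfl, map_smul' := fun _ _ => rfl }
  refine ⟨?_, ?_, ?_⟩
  · exact hasDerivAt_linear_comp L₁₁ h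
  · exact hasDerivAt_linear_comp L₁₂ h
  · have h3 := hasDerivAt_linear_comp L₂₁ h
    have : (fun t => L₂₁ (bogoliubov B C t)) = fun t => (Psi B C t).map conj := by
      funext t
      rw [bogoliubov_eq_fromBlocks]
      rfl
    rw [this] at h3
    exact h3

variable (hB : B.IsSymm) (hC : C.IsHermitian)
include hB hC

lemma hasDerivAt_inv_Phi (t : ℝ) : HasDerivAt (fun t => (Phi B C t)⁻¹)
    (Complex.I • (C * (Phi B C t)⁻¹ + outerBlock B C t * B.map conj * (Phi B C t)⁻¹)) t := by
  have hu := isUnit_det_Phi hB hC t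
  obtain ⟨u, hu'⟩ := (Matrix.isUnit_iff_isUnit_det _).2 hu
  have h1 := hasFDerivAt_ringInverse (𝕜 := ℝ) u
  rw [hu'] at h1
  have h2 := h1.comp_hasDerivAt t (hasDerivAt_blocks (B := B) (C := C) t).1
  have hinv : (↑u⁻¹ : Matrix (Fin n) (Fin n) ℂ) = (Phi B C t)⁻¹ := by
    rw [← hu', Matrix.coe_units_inv]
  have hf : (fun t => (Phi B C t)⁻¹) = Ring.inverse ∘ Phi B C := by
    funext t; exact Matrix.nonsing_inv_eq_ringInverse _
  rw [hf]
  convert! h2 using 1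
  simp only [neg_apply, ContinuousLinearMap.mulLeftRight_apply, hinv,
    outerBlock, mul_smul_comm, smul_mul_assoc, ← smul_neg]
  congr 1
  rw [mul_sub, sub_mul, Matrix.nonsing_inv_mul_cancel_left _ _ hu]
  noncomm_ring

/-- The Riccati equation for `A²²`. -/
lemma hasDerivAt_outerBlock (t : ℝ) : HasDerivAt (outerBlock B C)
    (Complex.I • (B + C * outerBlock B C t + outerBlock B C t * C.map conj +
      outerBlock B C t * B.map conj * outerBlock B C t)) t := by
  have hu := isUnit_det_Phi hB hC t
  have h := ((hasDerivAt_inv_Phi hB hC t).mul (hasDerivAt_blocks (B := B) (C := C) t).2.1).neg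
  convert! h using 1
  simp only [mul_smul_comm, smul_mul_assoc, ← smul_add, ← smul_neg, mul_sub,
    Matrix.nonsing_inv_mul_cancel_left _ _ hu]
  congr 1
  simp only [outerBlock]
  noncomm_ring

lemma hasDerivAt_innerBlock (t : ℝ) : HasDerivAt (innerBlock B C)
    (Complex.I • (((Phi B C t)⁻¹)ᵀ * B.map conj * (Phi B C t)⁻¹)) t := by
  have h := (hasDerivAt_blocks (B := B) (C := C) t).2.2.mul (hasDerivAt_inv_Phi hB hC t)
  convert! h using 1
  rw [← schur_complement hB hC]
  simp only [mul_smul_comm, smul_mul_assoc, ← smul_add]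
  congr 1
  simp only [outerBlock]
  noncomm_ring

lemma continuous_inv_Phi : Continuous fun t => (Phi B C t)⁻¹ :=
  continuous_iff_continuousAt.2 fun t => (hasDerivAt_inv_Phi hB hC t).continuousAt

lemma continuous_outerBlock : Continuous (outerBlock B C) :=
  continuous_iff_continuousAt.2 fun t => (hasDerivAt_outerBlock hB hC t).continuousAt

lemma continuous_innerBlock : Continuous (innerBlock B C) :=
  continuous_iff_continuousAt.2 fun t => (hasDerivAt_innerBlock hB hC t).continuousAt

omit hB hC in
lemma continuous_outerBound : Continuous (outerBound B C) := by
  have h : Continuous (Phi B C) :=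
    continuous_iff_continuousAt.2 fun t => (hasDerivAt_blocks (B := B) (C := C) t).1.continuousAt
  unfold outerBound
  refine Real.continuous_sqrt.comp (continuous_const.sub (continuous_const.div ?_ fun t => ?_))
  · simp only [Matrix.conjTranspose_apply]
    fun_prop
  · positivity

omit hB hC in
lemma hasDerivAt_dotProduct_mulVec {M : ℝ → Matrix (Fin n) (Fin n) ℂ}
    {M' : Matrix (Fin n) (Fin n) ℂ} {t : ℝ} (h : HasDerivAt M M' t) (x y : Fin n → ℂ) :
    HasDerivAt (fun t => x ⬝ᵥ M t *ᵥ y) (x ⬝ᵥ M' *ᵥ y) t :=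
  hasDerivAt_linear_comp
    { toFun := fun M : Matrix (Fin n) (Fin n) ℂ => x ⬝ᵥ M *ᵥ y
      map_add' := fun M N => by rw [Matrix.add_mulVec, dotProduct_add]
      map_smul' := fun c M => by simp [Matrix.smul_mulVec] } h

omit hB hC in
lemma Phi_zero : Phi B C 0 = 1 := by
  rw [Phi, bogoliubov_zero, ← Matrix.fromBlocks_one, Matrix.toBlocks_fromBlocks₁₁]

omit hB hC in
lemma Psi_zero : Psi B C 0 = 0 := by
  rw [Psi, bogoliubov_zero, ← Matrix.fromBlocks_one, Matrix.toBlocks_fromBlocks₁₂]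

/-- The normalization `c(t) = exp (½ i ∫₀ᵗ tr (B̄ A²²))`, which solves the transport equation
`c' = ½ i tr (B̄ A²²) c`. -/
noncomputable def normalization (B C : Matrix (Fin n) (Fin n) ℂ) (t : ℝ) : ℂ :=
  Complex.exp (∫ s in (0 : ℝ)..t, Complex.I / 2 * (B.map conj * outerBlock B C s).trace)

omit hB hC in
lemma normalization_zero : normalization B C 0 = 1 := by simp [normalization]

lemma hasDerivAt_normalization (t : ℝ) : HasDerivAt (normalization B C)
    (normalization B C t * (Complex.I / 2 * (B.map conj * outerBlock B C t).trace)) t := by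
  have hc : Continuous fun s => Complex.I / 2 * (B.map conj * outerBlock B C s).trace := by
    have := continuous_outerBlock hB hC
    simp only [Matrix.trace, Matrix.diag, Matrix.mul_apply]
    fun_prop
  exact (hc.integral_hasStrictDerivAt 0 t).hasDerivAt.cexp

/-- By Jacobi's formula `det (Φ e^{itC})` solves the transport equation of `c⁻²`. -/
lemma sq_normalization_mul_det (t : ℝ) : normalization B C t ^ 2 *
    (Phi B C t * NormedSpace.exp ((Complex.I * (t : ℂ)) • C)).det = 1 := by
  let W : ℝ → Matrix (Fin n) (Fin n) ℂ := fun t =>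
    Phi B C t * NormedSpace.exp ((Complex.I * (t : ℂ)) • C)
  have hW : ∀ t, HasDerivAt (fun t => (W t).det)
      (-(Complex.I * (W t).det * (B.map conj * outerBlock B C t).trace)) t := fun t => by
    set e := NormedSpace.exp ((Complex.I * (t : ℂ)) • C) with he
    have hu := isUnit_det_Phi hB hC t
    have hcomm : e * C = C * e :=
      (((Commute.refl C).smul_left (Complex.I * (t : ℂ))).exp_left : Commute e C)
    have h1 : HasDerivAt W (Complex.I • (Psi B C t * B.map conj * e)) t := by
      convert! (hasDerivAt_blocks (B := B) (C := C) t).1.mul (hasDerivAt_exp_I_smul C t) using 1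
      rw [← he, hcomm]
      simp only [mul_smul_comm, smul_mul_assoc, ← smul_add]
      congr 1
      noncomm_ring
    have h2 := hasDerivAt_det fun i j => hasDerivAt_linear_comp
      ({ toFun := fun M : Matrix (Fin n) (Fin n) ℂ => M i j
         map_add' := fun _ _ => rfl
         map_smul' := fun _ _ => rfl } : Matrix (Fin n) (Fin n) ℂ →ₗ[ℂ] ℂ) h1
    convert! h2 using 1
    have h3 : Complex.I • (Psi B C t * B.map conj * e) =
        W t * (Complex.I • (e⁻¹ * ((Phi B C t)⁻¹ * Psi B C t * B.map conj) * e)) := by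
      have hue : IsUnit e.det := (Matrix.isUnit_iff_isUnit_det _).1 (Matrix.isUnit_exp _)
      rw [mul_smul_comm]
      congr 1
      change _ = Phi B C t * e * _
      rw [mul_assoc (Phi B C t), mul_assoc e⁻¹, Matrix.mul_nonsing_inv_cancel_left _ _ hue,
        mul_assoc (Phi B C t)⁻¹, mul_assoc (Phi B C t)⁻¹,
        Matrix.mul_nonsing_inv_cancel_left _ _ hu]
    have hue : IsUnit e.det := (Matrix.isUnit_iff_isUnit_det _).1 (Matrix.isUnit_exp _)
    change _ = ((W t).adjugate * (Complex.I • (Psi B C t * B.map conj * e))).trace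
    rw [h3, ← mul_assoc, Matrix.adjugate_mul, Matrix.smul_mul, one_mul, Matrix.trace_smul,
      Matrix.trace_smul, Matrix.trace_mul_comm (e⁻¹ * _) e, ← mul_assoc e,
      Matrix.mul_nonsing_inv _ hue, one_mul, outerBlock, mul_neg, Matrix.trace_neg,
      Matrix.trace_mul_comm (B.map conj)]
    simp only [smul_eq_mul]
    ring
  have hd : ∀ s, HasDerivAt (fun s => normalization B C s ^ 2 * (W s).det) 0 s := fun s => by
    convert! ((hasDerivAt_normalization hB hC s).fun_pow 2).mul (hW s) using 1
    push_cast
    ring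
  have := is_const_of_deriv_eq_zero (fun s => (hd s).differentiableAt) (fun s => (hd s).deriv) t 0
  refine this.trans ?_
  simp [W, normalization_zero, Phi_zero]

end Derivatives

end Bargmann

/-! ### The Gaussian kernel and the unitary group -/

namespace Bargmann

open scoped Matrix

variable {n : ℕ}

section Kernel

lemma inner_smul_space (x y : space n) (c : ℂ) : ⟪x, c • y⟫_ℂ = c * ⟪x, y⟫_ℂ :=
  inner_smul_right (𝕜 := ℂ) x y c

lemma continuous_smul_space {f : ℝ → ℂ} {g : ℝ → space n} (hf : Continuous f)
    (hg : Continuous g) : Continuous fun t => f t • g t :=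
  Continuous.smul hf hg

variable {B C : Matrix (Fin n) (Fin n) ℂ}

/-- As a function of its first variable, the kernel is a multiple of a Gaussian with quadratic
part `A²²` and linear part `A²¹ w`. -/
lemma gaussianKernel_kernelMatrix (c : ℂ) (t : ℝ) (z w : Fin n → ℂ) :
    gaussianKernel c (kernelMatrix B C t) z w =
      c * Complex.exp (1 / 2 * (w ⬝ᵥ innerBlock B C t *ᵥ w)) *
        Complex.exp (quadForm (outerBlock B C t) ((Phi B C t)⁻¹ *ᵥ w) z) := by
  rw [gaussianKernel, mul_assoc, ← Complex.exp_add]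
  congr 2
  rw [kernelMatrix, Matrix.fromBlocks_mulVec, sumElim_dotProduct_sumElim]
  simp only [Sum.elim_comp_inl, Sum.elim_comp_inr, dotProduct_add]
  have h : w ⬝ᵥ (Phi B C t)⁻¹ᵀ *ᵥ z = z ⬝ᵥ (Phi B C t)⁻¹ *ᵥ w := by
    rw [Matrix.mulVec_transpose, dotProduct_comm, Matrix.dotProduct_mulVec]
  rw [h, quadForm, dotProduct_comm ((Phi B C t)⁻¹ *ᵥ w) z, innerBlock, outerBlock]
  ring

lemma symbol_eq {M : Matrix (Fin n) (Fin n) ℂ} (hM : M.IsSymm) (b z : Fin n → ℂ) (e : ℂ) :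
    symbol B C M b z e e e = (1 / 2 * (z ⬝ᵥ B *ᵥ z)
      + 1 / 2 * ((M *ᵥ z + b) ⬝ᵥ B.map conj *ᵥ (M *ᵥ z + b))
      + 1 / 2 * (B.map conj * M).trace + z ⬝ᵥ C *ᵥ (M *ᵥ z + b)) * e := by
  simp only [symbol]
  generalize M *ᵥ z + b = l
  simp only [dotProduct, Matrix.mulVec, Matrix.trace, Matrix.diag, Matrix.mul_apply,
    Matrix.map_apply, Finset.mul_sum, Finset.sum_mul, ← Finset.sum_add_distrib, add_mul]
  refine Finset.sum_congr rfl fun j _ => Finset.sum_congr rfl fun k _ => ?_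
  rw [hM.apply j k]
  ring

variable (hB : B.IsSymm) (hC : C.IsHermitian)
include hB hC

/-- The Gaussian kernel solves the Schrödinger equation in its first variable. -/
lemma hasDerivAt_gaussianKernel (z w : Fin n → ℂ) (t : ℝ) :
    HasDerivAt (fun t => gaussianKernel (normalization B C t) (kernelMatrix B C t) z w)
      (Complex.I * (normalization B C t * Complex.exp (1 / 2 * (w ⬝ᵥ innerBlock B C t *ᵥ w)) *
        symbol B C (outerBlock B C t) ((Phi B C t)⁻¹ *ᵥ w) z
          (Complex.exp (quadForm (outerBlock B C t) ((Phi B C t)⁻¹ *ᵥ w) z))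
          (Complex.exp (quadForm (outerBlock B C t) ((Phi B C t)⁻¹ *ᵥ w) z))
          (Complex.exp (quadForm (outerBlock B C t) ((Phi B C t)⁻¹ *ᵥ w) z)))) t := by
  have hS := isSymm_outerBlock hB hC t
  have hsymm : ∀ {M : Matrix (Fin n) (Fin n) ℂ}, M.IsSymm → ∀ x y : Fin n → ℂ,
      x ⬝ᵥ M *ᵥ y = (M *ᵥ x) ⬝ᵥ y := fun {M} hM x y => by
    rw [Matrix.dotProduct_mulVec, ← Matrix.mulVec_transpose, hM.eq]
  have hBs : (B.map conj).IsSymm := by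
    rw [Matrix.IsSymm, ← Matrix.transpose_map, hB.eq]
  have hq : ∀ s, quadForm (outerBlock B C s) ((Phi B C s)⁻¹ *ᵥ w) z =
      1 / 2 * (z ⬝ᵥ outerBlock B C s *ᵥ z) + z ⬝ᵥ (Phi B C s)⁻¹ *ᵥ w := fun s => by
    rw [quadForm, dotProduct_comm _ z]
  simp only [gaussianKernel_kernelMatrix, symbol_eq hS, hq]
  have h1 := hasDerivAt_normalization hB hC t
  have h2 := ((hasDerivAt_dotProduct_mulVec (hasDerivAt_innerBlock hB hC t) w w).const_mul (1 / 2)).cexp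
  have h3 := ((hasDerivAt_dotProduct_mulVec (hasDerivAt_outerBlock hB hC t) z z).const_mul
    (1 / 2)).fun_add (hasDerivAt_dotProduct_mulVec (hasDerivAt_inv_Phi hB hC t) z w)
  convert! (h1.fun_mul h2).fun_mul h3.cexp using 1
  set S := outerBlock B C t
  set P := (Phi B C t)⁻¹
  set b := P *ᵥ w with hb
  have e1 : w ⬝ᵥ (Pᵀ * B.map conj * P) *ᵥ w = b ⬝ᵥ B.map conj *ᵥ b := by
    rw [← Matrix.mulVec_mulVec, ← Matrix.mulVec_mulVec, Matrix.dotProduct_mulVec,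
      Matrix.vecMul_transpose]
  have e2 : z ⬝ᵥ (S * B.map conj * P) *ᵥ w = (S *ᵥ z) ⬝ᵥ B.map conj *ᵥ b := by
    rw [← Matrix.mulVec_mulVec, ← Matrix.mulVec_mulVec, hsymm hS]
  have e3 : z ⬝ᵥ (S * B.map conj * S) *ᵥ z = (S *ᵥ z) ⬝ᵥ B.map conj *ᵥ (S *ᵥ z) := by
    rw [← Matrix.mulVec_mulVec, ← Matrix.mulVec_mulVec, hsymm hS]
  have e4 : z ⬝ᵥ (S * C.map conj) *ᵥ z = z ⬝ᵥ C *ᵥ (S *ᵥ z) := by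
    rw [← Matrix.mulVec_mulVec, hsymm hS, Matrix.dotProduct_mulVec, ← Matrix.mulVec_transpose,
      transpose_map_conj, hC.eq, dotProduct_comm]
  have e5 : b ⬝ᵥ B.map conj *ᵥ (S *ᵥ z) = (S *ᵥ z) ⬝ᵥ B.map conj *ᵥ b := by
    rw [hsymm hBs, dotProduct_comm]
  simp only [Matrix.smul_mulVec, Matrix.add_mulVec, dotProduct_smul, dotProduct_add,
    Matrix.mulVec_add, add_dotProduct, smul_eq_mul, e1, e2, e3, e4, e5,
    ← Matrix.mulVec_mulVec w C P, ← Matrix.mulVec_mulVec z C S, ← hb]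
  ring

/-- The image of the coherent state `expVec w` at time `t`: the function `ū ↦ U(ū, w)`. -/
noncomputable def curve (w : Fin n → ℂ) (t : ℝ) : space n :=
  (normalization B C t * Complex.exp (1 / 2 * (w ⬝ᵥ innerBlock B C t *ᵥ w))) •
    gaussVec (formBound_outerBlock hB hC t) (outerBound_lt_one B C t) ((Phi B C t)⁻¹ *ᵥ w)

/-- The image of `curve` under the closure of the Hamiltonian. -/
noncomputable def curveImage (w : Fin n → ℂ) (t : ℝ) : space n :=
  (normalization B C t * Complex.exp (1 / 2 * (w ⬝ᵥ innerBlock B C t *ᵥ w))) •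
    gaussImage (formBound_outerBlock hB hC t) (outerBound_lt_one B C t) B C ((Phi B C t)⁻¹ *ᵥ w)

lemma inner_expVec_curve (u w : Fin n → ℂ) (t : ℝ) : ⟪expVec u, curve hB hC w t⟫_ℂ =
    gaussianKernel (normalization B C t) (kernelMatrix B C t) (star u) w := by
  rw [curve, inner_smul_space, inner_expVec_gaussVec, gaussianKernel_kernelMatrix]

lemma curve_zero (w : Fin n → ℂ) : curve hB hC w 0 = expVec w := by
  rw [← sub_eq_zero]
  refine eq_zero_of_inner_expVec fun u => ?_
  have h : ⟪expVec u, expVec w⟫_ℂ = Complex.exp (quadForm 0 w (star u)) :=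
    inner_expVec_gaussVec _ _ w u
  have h' : ⟪expVec u, curve hB hC w 0⟫_ℂ = ⟪expVec u, expVec w⟫_ℂ := by
    rw [inner_expVec_curve, gaussianKernel_kernelMatrix, h]
    simp [normalization_zero, innerBlock, outerBlock, Phi_zero, Psi_zero]
  exact (inner_sub_right (𝕜 := ℂ) _ _ _).trans (sub_eq_zero.2 h')

lemma continuous_curveImage (w : Fin n → ℂ) : Continuous (curveImage hB hC w) := by
  have h1 : Continuous (normalization B C) :=
    continuous_iff_continuousAt.2 fun t => (hasDerivAt_normalization hB hC t).continuousAt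
  have h2 := continuous_innerBlock hB hC
  have h3 := continuous_inv_Phi hB hC
  refine continuous_smul_space ?_ (continuous_gaussImage B C (continuous_outerBlock hB hC) ?_
    continuous_outerBound _ _)
  · fun_prop
  · fun_prop

lemma hasDerivAt_curve (w : Fin n → ℂ) (t : ℝ) :
    HasDerivAt (curve hB hC w) (Complex.I • curveImage hB hC w t) t := by
  refine hasDerivAt_of_weak (e := expVec) (f' := fun t => Complex.I • curveImage hB hC w t)
    (fun f hf => eq_zero_of_inner_expVec hf) (continuous_smul_space continuous_const (continuous_curveImage hB hC w))
    (fun u s => ?_) t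
  simp only [inner_expVec_curve, curveImage, inner_smul_space, inner_expVec_gaussImage]
  exact hasDerivAt_gaussianKernel hB hC (star u) w s

lemma isTotalEvolution_curve (hH : (hamiltonian B C).IsFormalAdjoint (hamiltonian B C)) :
    IsTotalEvolution (hamiltonian B C) (curve hB hC) (curveImage hB hC) where
  mem_graph w t := Submodule.smul_mem _ _
    (gaussVec_mem_graph hH (isSymm_outerBlock hB hC t) (formBound_outerBlock hB hC t)
      (outerBound_lt_one B C t) ((Phi B C t)⁻¹ *ᵥ w))
  hasDerivAt := hasDerivAt_curve hB hC
  total f hf := eq_zero_of_inner_expVec fun w => by rw [← curve_zero hB hC]; exact hf w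

/-- The kernel of the adjoint: `U(ū, v; t)` is the complex conjugate of `U(v̄, u; -t)`. -/
lemma conj_gaussianKernel (hH : (hamiltonian B C).IsFormalAdjoint (hamiltonian B C))
    (u v : Fin n → ℂ) (t : ℝ) :
    conj (gaussianKernel (normalization B C (-t)) (kernelMatrix B C (-t)) (star v) u) =
      gaussianKernel (normalization B C t) (kernelMatrix B C t) (star u) v := by
  have h := (isTotalEvolution_curve hB hC hH).inner_shift (dense_hamiltonian_domain B C) hH
    u v t (-t)
  rw [neg_add_cancel, curve_zero, curve_zero, inner_expVec_curve] at h
  rw [h, ← inner_expVec_curve hB hC]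
  exact inner_conj_symm (𝕜 := ℂ) (curve hB hC u (-t)) (expVec v)

lemma coeFn_curve (w : Fin n → ℂ) (t : ℝ) :
    (curve hB hC w t : Lp ℂ 2 (gaussian n)) =ᵐ[gaussian n] fun v =>
      gaussianKernel (normalization B C t) (kernelMatrix B C t) (star v) w := by
  filter_upwards [coeFn_ae_eq_inner_expVec (curve hB hC w t)] with v hv
  rw [hv, inner_expVec_curve]

/-- The reproducing property at `u` and unitarity express `(U t f)(ū)` as the inner product of `f`
with the orbit of `expVec u` at time `-t`. -/
lemma hasKernel_of_isUnitaryGroup (hH : (hamiltonian B C).IsFormalAdjoint (hamiltonian B C))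
    {U : ℝ → (space n ≃ₗᵢ[ℂ] space n)} (hU : IsUnitaryGroupOf (hamiltonian B C).closure U)
    (hcurve : ∀ w t, U t (curve hB hC w 0) = curve hB hC w t) (t : ℝ) :
    HasKernel (U t) (gaussianKernel (normalization B C t) (kernelMatrix B C t)) := by
  intro f
  have hae : ∀ u, (fun v => ⟪((curve hB hC u (-t) : Lp ℂ 2 (gaussian n)) :
      (Fin n → ℂ) → ℂ) v, (f : Lp ℂ 2 (gaussian n)) v⟫_ℂ) =ᵐ[gaussian n]
      fun v => gaussianKernel (normalization B C t) (kernelMatrix B C t) (star u) v *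
        (f : Lp ℂ 2 (gaussian n)) v := fun u => by
    filter_upwards [coeFn_curve hB hC u (-t)] with v hv
    rw [hv, RCLike.inner_apply, conj_gaussianKernel hB hC hH, mul_comm]
  refine ⟨fun u => (L2.integrable_inner (𝕜 := ℂ)
    (curve hB hC u (-t) : Lp ℂ 2 (gaussian n)) f).congr (hae u), ?_⟩
  filter_upwards [coeFn_ae_eq_inner_expVec (U t f)] with u hu
  have hin : ⟪curve hB hC u (-t), f⟫_ℂ = ⟪expVec u, U t f⟫_ℂ := by
    rw [← hcurve, ← (U t).inner_map_map, ← hU.map_add, add_neg_cancel, hU.map_zero, curve_zero]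
  rw [hu, ← hin]
  exact (L2.inner_def (𝕜 := ℂ) (curve hB hC u (-t) : Lp ℂ 2 (gaussian n)) f).trans
    (integral_congr_ae (hae u))

end Kernel

end Bargmann

theorem theorem4p4 (n : ℕ) (B C : Matrix (Fin n) (Fin n) ℂ) (hB : B.IsSymm)
    (hH : (Bargmann.hamiltonian B C).IsFormalAdjoint (Bargmann.hamiltonian B C)) :
    IsSelfAdjoint (Bargmann.hamiltonian B C).closure ∧
    ∃ U : ℝ → (Bargmann.space n ≃ₗᵢ[ℂ] Bargmann.space n),
      Bargmann.IsUnitaryGroupOf (Bargmann.hamiltonian B C).closure U ∧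
      (∀ V, Bargmann.IsUnitaryGroupOf (Bargmann.hamiltonian B C).closure V → V = U) ∧
      (∀ t : ℝ,
        Bargmann.bogoliubov B C t = Matrix.fromBlocks (Bargmann.Phi B C t) (Bargmann.Psi B C t)
          ((Bargmann.Psi B C t).map conj) ((Bargmann.Phi B C t).map conj) ∧
        IsUnit (Bargmann.Phi B C t).det ∧
        (Bargmann.kernelMatrix B C t).IsSymm) ∧
      ∃ c : ℝ → ℂ, Continuous c ∧ c 0 = 1 ∧
        ∀ t : ℝ,
          c t ^ 2 * (Bargmann.Phi B C t * NormedSpace.exp ((Complex.I * (t : ℂ)) • C)).det = 1 ∧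
          Bargmann.HasKernel (U t)
            (Bargmann.gaussianKernel (c t) (Bargmann.kernelMatrix B C t)) := by
  have hC := Bargmann.isHermitian_of_isFormalAdjoint hH
  obtain ⟨hsa, U, hU, huniq, hcurve⟩ := (Bargmann.isTotalEvolution_curve hB hC
    hH).isSelfAdjoint_closure (Bargmann.dense_hamiltonian_domain B C) hH
  refine ⟨hsa, U, hU, huniq, fun t => ⟨Bargmann.bogoliubov_eq_fromBlocks t,
    Bargmann.isUnit_det_Phi hB hC t, Bargmann.isSymm_kernelMatrix hB hC t⟩,
    Bargmann.normalization B C, ?_, Bargmann.normalization_zero, fun t =>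
    ⟨Bargmann.sq_normalization_mul_det hB hC t,
      Bargmann.hasKernel_of_isUnitaryGroup hB hC hH hU hcurve t⟩⟩
  exact continuous_iff_continuousAt.2 fun t =>
    (Bargmann.hasDerivAt_normalization hB hC t).continuousAt
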